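/- **Setting.** Consider the convex program $$(P)\qquad \min_{x\in C} f_0(x)\quad\text{s.t. } f_i(x)\le 0,\ i=1,\dots,m,$$ where $C\subseteq\mathbb R^n$ is nonempty, closed and convex and $f_0,\dots,f_m:\mathbb R^n\to\mathbb R$ are convex and lower semicontinuous, and its dual $$(D)\qquad \max_{y\ge 0}\ g_0(y),\qquad g_0(y)=\inf_{x\in C}\Big\{f_0(x)+\sum_{j=1}^m y_jf_j(x)\Big\}.$$ Write $F=(f_1,\dots,f_m)$, $Y(x,y,c)=\Pi_{\mathbb R^m_+}[y+cF(x)]$ (Euclidean projection onto $\mathbb R^m_+$), and $$L(x,y,c)=f_0(x)+\frac1{2c}\big[\|Y(x,y,c)\|^2-\|y\|^2\big]\ \text{ for } x\in C,\qquad L(x,y,c)=+\infty\ \text{ for } x\notin C.$$ The Halpern-accelerated inexact augmented Lagrangian method is as follows. Let the parameters satisfy $c_k\ge \underline c>0$ for all $k$ and let $\varepsilon_k\ge 0$ with $\sum_k\varepsilon_k<\infty$. Choose $y^0\in\mathbb R^m_+$, and for $k=0,1,2,\dots$, with $\phi_k(x)=L(x,y^k,c_k)$, compute $x^{k+1}$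 such that $$(C)\qquad \phi_k(x^{k+1})-\inf\phi_k\le \frac{\varepsilon_k^2}{2c_k},$$ and set $$\bar y^k=Y(x^{k+1},y^k,c_k),\qquad y^{k+1}=\frac1{k+2}\,y^0+\frac{k+1}{k+2}\,\bar y^k .$$ Call a sequence $\{x^k\}\subseteq C$ asymptotically feasible if $\limsup_k f_i(x^k)\le0$ for $i=1,\dots,m$. The asymptotic infimum $\operatorname{asym\,inf}(P)$ is the infimum of $\limsup_k f_0(x^k)$ over all asymptotically feasible sequences, and an asymptotically feasible sequence attaining this value is called asymptotically minimizing. **Theorem.** Suppose $\sup(D)>-\infty$, and let $\{y^k\}_{k\ge0}$ and $\{x^k\}_{k\ge1}$ be generated by the method above. Then $\{y^k\}\subset\mathbb R^m_+$, and the following hold. 1. If $\{y^k\}$ is bounded, then $y^k\to y^\infty$ for some optimal solution $y^\infty$ of $(D)$; the sequence $\{x^k\}_{k\ge 1}$ is asymptotically minimizing for $(P)$; for $i=1,\dots,m$ and all $k\ge0$, $$f_i(x^{k+1})\le\frac1{c_k}\Big\{y_i^{k+1}-y_i^k+\frac1{k+1}\big[y_i^{k+1}-y_i^0\big]\Big\},$$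 where the right-hand side tends to $0$ as $k\to\infty$; and $\operatorname{asym\,inf}(P)$ is finite with, for all $k\ge 0$, $$f_0(x^{k+1})-\operatorname{asym\,inf}(P)\le\frac1{2c_k}\Big[\varepsilon_k^2+\|y^k\|^2-\|y^{k+1}\|^2-\frac{2k+3}{(k+1)^2}\Big\langle y^{k+1}-y^0,\ y^{k+1}-\frac1{2k+3}y^0\Big\rangle\Big].$$ 2. $\{y^k\}$ is bounded if and only if $(D)$ has an optimal solution. 3. If $(P)$ satisfies the Slater condition (there is $x\in C$ with $f_i(x)<0$ for $i=1,\dots,m$), then $\{y^k\}$ is bounded, the maximum in $(D)$ is attained, and $\max(D)=\inf(P)=\operatorname{asym\,inf}(P)$. 4. If $\{y^k\}$ is bounded and there is $\alpha_0\in\mathbb R$ such that the set $\{x\in\mathbb R^n: x \text{ is feasible for }(P)\text{ and } f_0(x)\le\alpha_0\}$ is nonempty and bounded, then $\{x^k\}_{k\ge 1}$ is bounded and each of its cluster points is an optimal solution of $(P)$. -/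

import Mathlib

open Filter Topology

noncomputable section

/-- Data of the convex program
`(P)  minimize f₀(x)  subject to  x ∈ C,  fᵢ(x) ≤ 0  (i = 1, …, m)`
in `ℝⁿ`, with `C` nonempty, closed and convex, and `f₀, f₁, …, fₘ : ℝⁿ → ℝ` convex and
lower semicontinuous. -/
structure ConvexProgram (n m : ℕ) where
  C : Set (EuclideanSpace ℝ (Fin n))
  f₀ : EuclideanSpace ℝ (Fin n) → ℝ
  f : Fin m → EuclideanSpace ℝ (Fin n) → ℝ
  nonempty_C : C.Nonempty
  isClosed_C : IsClosed C
  convex_C : Convex ℝ C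
  convexOn_f₀ : ConvexOn ℝ Set.univ f₀
  lsc_f₀ : LowerSemicontinuous f₀
  convexOn_f : ∀ i, ConvexOn ℝ Set.univ (f i)
  lsc_f : ∀ i, LowerSemicontinuous (f i)

namespace ConvexProgram

variable {n m : ℕ} (P : ConvexProgram n m)

/-- Feasible points of `(P)`. -/
def Feasible (x : EuclideanSpace ℝ (Fin n)) : Prop :=
  x ∈ P.C ∧ ∀ i, P.f i x ≤ 0

/-- The optimal value `inf (P)`, equal to `+∞` when `(P)` is infeasible. -/
def primalInf : EReal :=
  ⨅ (x : EuclideanSpace ℝ (Fin n)) (_ : P.Feasible x), (P.f₀ x : EReal)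

/-- Optimal solutions of `(P)`. -/
def IsPrimalOptimal (x : EuclideanSpace ℝ (Fin n)) : Prop :=
  P.Feasible x ∧ ∀ z, P.Feasible z → P.f₀ x ≤ P.f₀ z

/-- The Slater condition: some point of `C` satisfies all inequality constraints strictly. -/
def Slater : Prop :=
  ∃ x ∈ P.C, ∀ i, P.f i x < 0

/-- The dual function `g₀(y) = inf_{x ∈ C} { f₀(x) + ∑ⱼ yⱼ fⱼ(x) }`, with values in `[-∞, ∞)`. -/
def dualFun (y : EuclideanSpace ℝ (Fin m)) : EReal :=
  ⨅ x ∈ P.C, ((P.f₀ x + ∑ j, y j * P.f j x : ℝ) : EReal)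

/-- The optimal value `sup (D)` of the dual problem `maximize g₀(y) subject to y ≥ 0`. -/
def dualSup : EReal :=
  ⨆ (y : EuclideanSpace ℝ (Fin m)) (_ : ∀ i, 0 ≤ y i), P.dualFun y

/-- Optimal solutions of the dual problem `(D)`. -/
def IsDualOptimal (y : EuclideanSpace ℝ (Fin m)) : Prop :=
  (∀ i, 0 ≤ y i) ∧ ∀ u : EuclideanSpace ℝ (Fin m), (∀ i, 0 ≤ u i) → P.dualFun u ≤ P.dualFun y

/-- The multiplier update `Y(x, y, c)`: the Euclidean projection of `y + c F(x)` onto the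
nonnegative orthant, where `F = (f₁, …, fₘ)`. -/
def multiplier (x : EuclideanSpace ℝ (Fin n)) (y : EuclideanSpace ℝ (Fin m)) (c : ℝ) :
    EuclideanSpace ℝ (Fin m) :=
  WithLp.toLp 2 fun i => max (y i + c * P.f i x) 0

open Classical in
/-- The augmented Lagrangian
`L(x, y, c) = f₀(x) + (1 / 2c) (‖Y(x, y, c)‖² - ‖y‖²)` for `x ∈ C`, and `+∞` for `x ∉ C`. -/
def augLagrangian (x : EuclideanSpace ℝ (Fin n)) (y : EuclideanSpace ℝ (Fin m)) (c : ℝ) : EReal :=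
  if x ∈ P.C then
    ((P.f₀ x + 1 / (2 * c) * (‖P.multiplier x y c‖ ^ 2 - ‖y‖ ^ 2) : ℝ) : EReal)
  else ⊤

/-- Sequences in `C` that satisfy the constraints in the limit:
`limsup fᵢ(xᵏ) ≤ 0` for every `i`. -/
def AsympFeasible (x : ℕ → EuclideanSpace ℝ (Fin n)) : Prop :=
  (∀ k, x k ∈ P.C) ∧ ∀ i, limsup (fun k => (P.f i (x k) : EReal)) atTop ≤ 0

/-- The asymptotic infimum of `(P)`: the infimum of `limsup f₀(xᵏ)` over all asymptotically
feasible sequences. -/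
def asympInf : EReal :=
  ⨅ (x : ℕ → EuclideanSpace ℝ (Fin n)) (_ : P.AsympFeasible x),
    limsup (fun k => (P.f₀ (x k) : EReal)) atTop

/-- Asymptotically minimizing sequences for `(P)`. -/
def IsAsympMinimizing (x : ℕ → EuclideanSpace ℝ (Fin n)) : Prop :=
  P.AsympFeasible x ∧ limsup (fun k => (P.f₀ (x k) : EReal)) atTop = P.asympInf

/-- `P.IsRun c ε x y`: the sequences `x`, `y` are generated by the Halpern-accelerated inexact
augmented Lagrangian method with penalty parameters `c k > 0` bounded away from zero and
summable tolerances `ε k ≥ 0`. The method starts at `y 0 ≥ 0`; the primal iterates are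
`x 1, x 2, …` (the value `x 0` plays no role). -/
structure IsRun (c ε : ℕ → ℝ) (x : ℕ → EuclideanSpace ℝ (Fin n))
    (y : ℕ → EuclideanSpace ℝ (Fin m)) : Prop where
  c_bound : ∃ c₀ : ℝ, 0 < c₀ ∧ ∀ k, c₀ ≤ c k
  ε_nonneg : ∀ k, 0 ≤ ε k
  ε_summable : Summable ε
  y_zero : ∀ i, 0 ≤ y 0 i
  /-- Stopping criterion: `φₖ(xᵏ⁺¹) - inf φₖ ≤ εₖ² / (2 cₖ)`, where `φₖ = L(·, yᵏ, cₖ)`. -/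
  criterion : ∀ k, P.augLagrangian (x (k + 1)) (y k) (c k) -
    (⨅ z : EuclideanSpace ℝ (Fin n), P.augLagrangian z (y k) (c k)) ≤
      ((ε k ^ 2 / (2 * c k) : ℝ) : EReal)
  /-- Halpern step `yᵏ⁺¹ = (1/(k+2)) y⁰ + ((k+1)/(k+2)) Y(xᵏ⁺¹, yᵏ, cₖ)`. -/
  step : ∀ k, y (k + 1) = ((1 : ℝ) / ((k : ℝ) + 2)) • y 0 +
    (((k : ℝ) + 1) / ((k : ℝ) + 2)) • P.multiplier (x (k + 1)) (y k) (c k)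

end ConvexProgram

end

/-! The method is a Halpern iteration on the dual. For `x ∈ C` the augmented Lagrangian is the
maximum over `u ≥ 0` of the Lagrangian minus `‖u - y‖² / (2c)`, attained at the multiplier update.
Interchanging inf and max (`exists_dual_point_of_strongly_concave`) shows that the update is within
`ε k` of the proximal point of the dual function at `y k` (`exists_isProxPoint`).

A Halpern proximal iteration with parameters bounded below and summable errors stays bounded once a
maximizer exists (`halpern_norm_sub_le`). Conversely, if it is bounded, a maximizer exists and the
iterates converge to one (`halpern_tendsto_of_isBounded`).

On the primal side, the update bounds each constraint by a vanishing multiplier increment, and the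
stopping rule bounds the objective by `max (D)` plus a vanishing term. Weak duality survives along
asymptotically feasible sequences (`dualSup_le_asympInf`), so the primal iterates attain the
asymptotic infimum. Under Slater the dual superlevel sets are bounded, and a small shift towards the
Slater point restores feasibility, which closes the duality gap. -/

noncomputable section

/-! ### Minimax without compactness -/

/-- A minimax principle: if `h` is convex in its first argument and strongly concave in the second,
then the value `inf L`, where `L x = max h x`, is attained by a dual point. -/
theorem exists_dual_point_of_strongly_concave {V E : Type*} [AddCommGroup V] [Module ℝ V]
    [NormedAddCommGroup E] [InnerProductSpace ℝ E] [CompleteSpace E]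
    {C : Set V} (hC : Convex ℝ C) {K : Set E} (hK : IsClosed K)
    {h : V → E → ℝ} {L : V → ℝ} {Y : V → E} {κ r : ℝ} (hκ : 0 < κ)
    (hconv : ∀ u ∈ K, ConvexOn ℝ C fun x => h x u) (hcont : ∀ x, Continuous (h x))
    (hY : ∀ x, Y x ∈ K) (hLY : ∀ x, h x (Y x) = L x)
    (hL : ∀ x, ∀ u ∈ K, h x u ≤ L x - κ * ‖u - Y x‖ ^ 2)
    (hr : ∀ x ∈ C, r ≤ L x) (hr' : ∀ δ > 0, ∃ x ∈ C, L x < r + δ) :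
    ∃ p ∈ K, ∀ x ∈ C, r ≤ h x p := by
  -- Comparing with the midpoint `z`: since `r ≤ L z`, the quadratic losses at `Y z` leave no room
  -- for `Y x` and `Y x'` to be far apart.
  have near : ∀ δ, ∀ x ∈ C, ∀ x' ∈ C, L x ≤ r + δ → L x' ≤ r + δ →
      κ * ‖Y x - Y x'‖ ^ 2 ≤ 4 * δ := by
    intro δ x hx x' hx' h1 h2
    set z := (1 / 2 : ℝ) • x + (1 / 2 : ℝ) • x'
    have hz : z ∈ C := hC hx hx' (by norm_num) (by norm_num) (by norm_num)
    have h3 : L z ≤ 1 / 2 * h x (Y z) + 1 / 2 * h x' (Y z) := by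
      rw [← hLY z]
      exact (hconv (Y z) (hY z)).2 hx hx' (by norm_num) (by norm_num) (by norm_num)
    have h4 := hL x (Y z) (hY z)
    have h5 := hL x' (Y z) (hY z)
    have h6 := hr z hz
    have h7 : ‖Y x - Y x'‖ ^ 2 ≤ 2 * (‖Y z - Y x‖ ^ 2 + ‖Y z - Y x'‖ ^ 2) := by
      have : ‖Y x - Y x'‖ ≤ ‖Y z - Y x‖ + ‖Y z - Y x'‖ := by
        rw [norm_sub_rev (Y z) (Y x)]
        exact norm_sub_le_norm_sub_add_norm_sub _ _ _
      nlinarith [norm_nonneg (Y x - Y x'), sq_nonneg (‖Y z - Y x‖ - ‖Y z - Y x'‖)]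
    nlinarith [mul_le_mul_of_nonneg_left h7 hκ.le]
  set t : ℕ → ℝ := fun j => 1 / ((j : ℝ) + 1)
  have ht0 : ∀ j, 0 < t j := fun j => by positivity
  have ht1 : ∀ j, t j ≤ 1 := fun j => by
    simp only [t]; rw [div_le_one (by positivity)]; linarith [Nat.cast_nonneg (α := ℝ) j]
  have htlim : Tendsto t atTop (𝓝 0) := tendsto_one_div_add_atTop_nhds_zero_nat
  have tmono : ∀ i j, i ≤ j → t j ≤ t i := fun i j hij => by
    simp only [t]; gcongr
  -- Accuracy `t j ^ 2` rather than `t j`: the error must still vanish after `hfin` divides by the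
  -- weight `t j` given to `x'`.
  choose xs hxC hxL using fun j => hr' (t j ^ 2) (by have := ht0 j; positivity)
  have sq_lim : ∀ {a : ℕ → E} {B : ℝ}, (∀ j, κ * ‖a j‖ ^ 2 ≤ 4 * (t j * B)) →
      Tendsto a atTop (𝓝 0) := by
    intro a B ha
    rw [tendsto_zero_iff_norm_tendsto_zero]
    have h1 : Tendsto (fun j => ‖a j‖ ^ 2) atTop (𝓝 0) := by
      refine squeeze_zero (fun j => by positivity) (g := fun j => 4 * (t j * B) / κ)
        (fun j => ?_) ?_
      · rw [le_div_iff₀ hκ]; linarith [ha j]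
      · simpa using ((htlim.mul_const B).const_mul 4).div_const κ
    have h2 := h1.sqrt
    simpa [Real.sqrt_sq] using h2
  have hcauchy : CauchySeq fun j => Y (xs j) := by
    refine cauchySeq_of_le_tendsto_0 (fun N => Real.sqrt (4 * t N ^ 2 / κ)) ?_ ?_
    · intro i j N hi hj
      rw [dist_eq_norm]
      apply Real.le_sqrt_of_sq_le
      rw [le_div_iff₀ hκ]
      have := near (t N ^ 2) _ (hxC i) _ (hxC j)
        ((hxL i).le.trans (by have := tmono N i hi; have := ht0 i; gcongr))
        ((hxL j).le.trans (by have := tmono N j hj; have := ht0 j; gcongr))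
      linarith
    · simpa using (((htlim.pow 2).const_mul 4).div_const κ).sqrt
  obtain ⟨p, hp⟩ := cauchySeq_tendsto_of_complete hcauchy
  refine ⟨p, hK.mem_of_tendsto hp (Eventually.of_forall fun j => hY _), fun x' hx' => ?_⟩
  set z : ℕ → V := fun j => (1 - t j) • xs j + t j • x'
  have hzC : ∀ j, z j ∈ C := fun j =>
    hC (hxC j) hx' (by linarith [ht1 j]) (ht0 j).le (by ring)
  have hz1 : ∀ j, L (z j) ≤ (1 - t j) * h (xs j) (Y (z j)) + t j * h x' (Y (z j)) := by
    intro j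
    rw [← hLY]
    exact (hconv (Y (z j)) (hY _)).2 (hxC j) hx' (by linarith [ht1 j]) (ht0 j).le (by ring)
  have hle : ∀ x, ∀ u ∈ K, h x u ≤ L x := fun x u hu =>
    (hL x u hu).trans (by have : 0 ≤ κ * ‖u - Y x‖ ^ 2 := by positivity
                          linarith)
  have hB : ∀ j, L (z j) ≤ r + t j * (1 + (L x' - r)) := by
    intro j
    have h1 := hle (xs j) _ (hY (z j))
    have h2 := hle x' _ (hY (z j))
    have h3 := hz1 j
    have h4 := mul_le_mul_of_nonneg_left (h1.trans (hxL j).le) (sub_nonneg.2 (ht1 j))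
    have h5 := mul_le_mul_of_nonneg_left h2 (ht0 j).le
    nlinarith [ht0 j, ht1 j, mul_nonneg (ht0 j).le (sub_nonneg.2 (ht1 j)),
      mul_nonneg (sq_nonneg (t j)) (ht0 j).le]
  have hB' : ∀ j, L (xs j) ≤ r + t j * (1 + (L x' - r)) := by
    intro j
    have := hxL j
    have := hr x' hx'
    nlinarith [ht0 j, ht1 j, mul_nonneg (ht0 j).le (sub_nonneg.2 this)]
  have hYz : Tendsto (fun j => Y (z j)) atTop (𝓝 p) := by
    have h1 := sq_lim (a := fun j => Y (z j) - Y (xs j)) fun j =>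
      near _ _ (hzC j) _ (hxC j) (hB j) (hB' j)
    simpa using h1.add hp
  have hfin : ∀ j, r ≤ h x' (Y (z j)) + t j := by
    intro j
    have h1 := (hr _ (hzC j)).trans (hz1 j)
    have h4 := mul_le_mul_of_nonneg_left ((hle (xs j) _ (hY (z j))).trans (hxL j).le)
      (sub_nonneg.2 (ht1 j))
    have : t j * r ≤ t j * (h x' (Y (z j)) + t j) := by
      nlinarith [ht0 j, mul_nonneg (sq_nonneg (t j)) (ht0 j).le]
    exact le_of_mul_le_mul_left this (ht0 j)
  have hlim : Tendsto (fun j => h x' (Y (z j)) + t j) atTop (𝓝 (h x' p + 0)) :=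
    (((hcont x').tendsto p).comp hYz).add htlim
  simpa using ge_of_tendsto' hlim hfin

/-! ### Scalar recursions -/

/-- A Robbins–Siegmund type lemma for the step sizes `1 / (k + 2)`. -/
theorem tendsto_zero_of_halpern_recursion {a D : ℕ → ℝ} (ha : ∀ k, 0 ≤ a k)
    (hrec : ∀ k : ℕ, ((k : ℝ) + 2) * a (k + 1) ≤ ((k : ℝ) + 1) * a k + D k)
    (hD : ∀ δ > 0, ∀ᶠ k in atTop, D k ≤ δ) : Tendsto a atTop (𝓝 0) := by
  rw [Metric.tendsto_atTop]
  intro δ hδ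
  obtain ⟨K, hK⟩ := eventually_atTop.1 (hD (δ / 2) (by linarith))
  -- The weighted quantity `(k + 1) * a k` telescopes, so `a k` is an average of the `D k` up to a
  -- term of order `1 / k`.
  have h1 : ∀ j : ℕ, ((K + j : ℕ) + 1 : ℝ) * a (K + j) ≤ (K + 1) * a K + j * (δ / 2) := by
    intro j
    induction j with
    | zero => simp
    | succ j ih =>
      have := hrec (K + j)
      have := hK (K + j) (by omega)
      push_cast [← add_assoc] at *
      nlinarith
  obtain ⟨N, hN⟩ := exists_nat_gt (((K : ℝ) + 1) * a K / (δ / 2))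
  refine ⟨K + N, fun k hk => ?_⟩
  obtain ⟨j, rfl⟩ := Nat.exists_eq_add_of_le (show K ≤ k by omega)
  have hj : (N : ℝ) ≤ j := by exact_mod_cast (by omega : N ≤ j)
  rw [Real.dist_eq, sub_zero, abs_of_nonneg (ha _)]
  have h2 := h1 j
  rw [div_lt_iff₀ (by linarith)] at hN
  have h3 : ((K + j : ℕ) + 1 : ℝ) * a (K + j) < ((K + j : ℕ) + 1 : ℝ) * δ := by
    push_cast at *
    nlinarith [Nat.cast_nonneg (α := ℝ) K]
  exact lt_of_mul_lt_mul_left h3 (by positivity)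

/-- Adding the tail sum to a Lyapunov quantity absorbs the additive errors: each `ε k` is paid for
by the drop from `τ k` to `τ (k + 1)`. -/
theorem exists_tail_of_summable {ε : ℕ → ℝ} (h0 : ∀ k, 0 ≤ ε k) (hs : Summable ε) :
    ∃ τ : ℕ → ℝ, (∀ k, 0 ≤ τ k) ∧ (∀ k, τ k = ε k + τ (k + 1)) ∧ Tendsto τ atTop (𝓝 0) := by
  refine ⟨fun k => ∑' j, ε (j + k), fun k => tsum_nonneg fun j => h0 _, fun k => ?_,
    tendsto_sum_nat_add ε⟩
  have := ((summable_nat_add_iff k).2 hs).tsum_eq_zero_add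
  simp only [this, zero_add]
  congr 1
  refine tsum_congr fun j => ?_
  congr 1; omega

/-! ### Inexact Halpern proximal point iteration -/

section Halpern

variable {E : Type*} [NormedAddCommGroup E] [InnerProductSpace ℝ E]

/-- The proximal inequality: `p` is the resolvent point of `-g` at `y` with parameter `c`. -/
def IsProxPoint (S : Set E) (g : E → ℝ) (c : ℝ) (y p : E) : Prop :=
  p ∈ S ∧ ∀ u ∈ S, g u ≤ g p + inner ℝ (u - p) (p - y) / c

/-- Test the proximal inequality at `s`, expand `‖y - s‖²` around `p` and drop `‖p - y‖²`. At a
maximizer `s` this is Fejér monotonicity with a gain proportional to the optimality gap. -/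
theorem IsProxPoint.norm_sub_sq_le {S : Set E} {g : E → ℝ} {c : ℝ} {y p s : E} (hc : 0 < c)
    (h : IsProxPoint S g c y p) (hs : s ∈ S) :
    ‖p - s‖ ^ 2 + 2 * c * (g s - g p) ≤ ‖y - s‖ ^ 2 := by
  have h1 := h.2 s hs
  have h2 : c * (g s - g p) ≤ inner ℝ (s - p) (p - y) := by
    have : g s - g p ≤ inner ℝ (s - p) (p - y) / c := by linarith
    rw [le_div_iff₀ hc] at this; linarith
  have h3 : ‖y - s‖ ^ 2 = ‖p - s‖ ^ 2 + 2 * inner ℝ (s - p) (p - y) + ‖p - y‖ ^ 2 := by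
    have : y - s = -((s - p) + (p - y)) := by abel
    rw [this, norm_neg, norm_add_sq_real, norm_sub_rev s p]
  nlinarith [sq_nonneg ‖p - y‖]

variable {S : Set E} {g : E → ℝ} {c ε : ℕ → ℝ} {y p w : ℕ → E}

theorem halpern_step_sub
    (hstep : ∀ k : ℕ, y (k + 1) = ((1 : ℝ) / ((k : ℝ) + 2)) • y 0 +
      (((k : ℝ) + 1) / ((k : ℝ) + 2)) • w k) (s : E) (k : ℕ) :
    y (k + 1) - s = ((1 : ℝ) / ((k : ℝ) + 2)) • (y 0 - s) +
      (((k : ℝ) + 1) / ((k : ℝ) + 2)) • (w k - s) := by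
  have h2 : ((k : ℝ) + 1) / ((k : ℝ) + 2) = 1 - 1 / ((k : ℝ) + 2) := by field_simp; ring
  rw [hstep, h2]; module

theorem halpern_norm_sub_le (hε0 : ∀ k, 0 ≤ ε k) (hε : Summable ε) (hc : ∀ k, 0 < c k)
    (hp : ∀ k, IsProxPoint S g (c k) (y k) (p k)) (hw : ∀ k, ‖w k - p k‖ ≤ ε k)
    (hstep : ∀ k : ℕ, y (k + 1) = ((1 : ℝ) / ((k : ℝ) + 2)) • y 0 +
      (((k : ℝ) + 1) / ((k : ℝ) + 2)) • w k)
    {s : E} (hs : s ∈ S) (hmax : ∀ u ∈ S, g u ≤ g s) :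
    ∃ R, ∀ k, ‖y k - s‖ ≤ R := by
  obtain ⟨τ, hτ0, hτ, -⟩ := exists_tail_of_summable hε0 hε
  have h1 : ∀ k, ‖p k - s‖ ≤ ‖y k - s‖ := fun k => by
    have := (hp k).norm_sub_sq_le (hc k) hs
    have := mul_nonneg (mul_nonneg zero_le_two (hc k).le) (sub_nonneg.2 (hmax _ (hp k).1))
    exact abs_le_of_sq_le_sq' (by linarith) (norm_nonneg _) |>.2
  -- Both points averaged in the Halpern step satisfy this bound with `τ (k + 1)` on the left, hence
  -- so does their average.
  have h2 : ∀ k, ‖y k - s‖ + τ k ≤ ‖y 0 - s‖ + τ 0 := by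
    intro k
    induction k with
    | zero => exact le_rfl
    | succ k ih =>
      have e := halpern_step_sub hstep s k
      have h3 : ‖y (k + 1) - s‖ ≤ (1 : ℝ) / ((k : ℝ) + 2) * ‖y 0 - s‖ +
          ((k : ℝ) + 1) / ((k : ℝ) + 2) * ‖w k - s‖ := by
        rw [e]; refine (norm_add_le _ _).trans (le_of_eq ?_)
        rw [norm_smul, norm_smul, Real.norm_of_nonneg (by positivity),
          Real.norm_of_nonneg (by positivity)]
      have h4 : ‖w k - s‖ ≤ ‖y k - s‖ + ε k := by
        have := norm_sub_le_norm_sub_add_norm_sub (w k) (p k) s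
        linarith [hw k, h1 k]
      have h5 : ‖w k - s‖ ≤ ‖y 0 - s‖ + τ 0 - τ (k + 1) := by linarith [hτ k]
      have h6 : ‖y 0 - s‖ ≤ ‖y 0 - s‖ + τ 0 - τ (k + 1) := by
        have : τ (k + 1) ≤ τ 0 := by
          have : Antitone τ := antitone_nat_of_succ_le fun k => by linarith [hτ k, hε0 k]
          exact this (Nat.zero_le _)
        linarith
      have hk : (1 : ℝ) / ((k : ℝ) + 2) + ((k : ℝ) + 1) / ((k : ℝ) + 2) = 1 := by field_simp; ring
      have ha : (0 : ℝ) ≤ 1 / ((k : ℝ) + 2) := by positivity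
      have hb : (0 : ℝ) ≤ ((k : ℝ) + 1) / ((k : ℝ) + 2) := by positivity
      have := mul_le_mul_of_nonneg_left h6 ha
      have := mul_le_mul_of_nonneg_left h5 hb
      have : (1 : ℝ) / ((k : ℝ) + 2) * (‖y 0 - s‖ + τ 0 - τ (k + 1)) +
        ((k : ℝ) + 1) / ((k : ℝ) + 2) * (‖y 0 - s‖ + τ 0 - τ (k + 1)) =
          ‖y 0 - s‖ + τ 0 - τ (k + 1) := by rw [← add_mul, hk, one_mul]
      linarith
  exact ⟨‖y 0 - s‖ + τ 0, fun k => by linarith [h2 k, hτ0 k]⟩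

/-- Solves the Halpern step for `w k`. It is the source of the `1 / (k + 1)` terms in the final
estimates. -/
theorem halpern_increment_eq
    (hstep : ∀ k : ℕ, y (k + 1) = ((1 : ℝ) / ((k : ℝ) + 2)) • y 0 +
      (((k : ℝ) + 1) / ((k : ℝ) + 2)) • w k) (k : ℕ) :
    w k - y (k + 1) = ((1 : ℝ) / ((k : ℝ) + 1)) • (y (k + 1) - y 0) := by
  rw [hstep, smul_sub, smul_add, smul_smul, smul_smul]
  have h1 : (1 : ℝ) / ((k : ℝ) + 1) * (((k : ℝ) + 1) / ((k : ℝ) + 2)) = 1 / ((k : ℝ) + 2) := by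
    field_simp
  have h2 : ((k : ℝ) + 1) / ((k : ℝ) + 2) = 1 - 1 / ((k : ℝ) + 2) := by field_simp; ring
  have h3 : (1 : ℝ) / ((k : ℝ) + 1) * (1 / ((k : ℝ) + 2)) =
    1 / ((k : ℝ) + 1) - 1 / ((k : ℝ) + 2) := by field_simp; ring
  rw [h1, h2, h3]; module

theorem halpern_increment_tendsto_zero
    (hstep : ∀ k : ℕ, y (k + 1) = ((1 : ℝ) / ((k : ℝ) + 2)) • y 0 +
      (((k : ℝ) + 1) / ((k : ℝ) + 2)) • w k) (hy : Bornology.IsBounded (Set.range y)) :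
    Tendsto (fun k => w k - y (k + 1)) atTop (𝓝 0) := by
  obtain ⟨R, hR⟩ := hy.exists_norm_le
  rw [tendsto_zero_iff_norm_tendsto_zero]
  refine squeeze_zero (fun _ => norm_nonneg _) (g := fun k : ℕ => (1 : ℝ) / ((k : ℝ) + 1) * (2 * R))
    (fun k => ?_) (by simpa using tendsto_one_div_add_atTop_nhds_zero_nat.mul_const (2 * R))
  rw [halpern_increment_eq hstep, norm_smul, Real.norm_of_nonneg (by positivity)]
  have := norm_sub_le (y (k + 1)) (y 0)
  have := hR _ (Set.mem_range_self (k + 1))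
  have := hR _ (Set.mem_range_self 0)
  gcongr; linarith

/-- Near-maximizers of an upper semicontinuous function satisfy the variational inequality of the
projection onto the set of maximizers up to a small error. -/
theorem exists_near_maximizer_inner_le [FiniteDimensional ℝ E]
    (hclosed : ∀ r, IsClosed {u | u ∈ S ∧ r ≤ g u}) {s z : E}
    (hproj : ∀ q ∈ S, g s ≤ g q → inner ℝ (z - s) (q - s) ≤ 0) (R : ℝ) {δ : ℝ} (hδ : 0 < δ) :
    ∃ σ > 0, ∀ u ∈ S, ‖u - s‖ ≤ R → g s - g u ≤ σ → inner ℝ (z - s) (u - s) ≤ δ := by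
  have : ProperSpace E := FiniteDimensional.proper ℝ E
  by_contra! hcon
  choose u huS huR hug hu using fun j : ℕ => hcon (1 / ((j : ℝ) + 1)) (by positivity)
  obtain ⟨q, -, φ, hφ, hq⟩ := tendsto_subseq_of_bounded
    (Metric.isBounded_closedBall (x := s) (r := R)) (x := u)
    (fun j => by simpa [dist_eq_norm] using huR j)
  -- Each superlevel set below `g s` is closed and eventually contains the subsequence, so `q` is as
  -- good as `s`.
  have hmem : ∀ n : ℕ, q ∈ {u | u ∈ S ∧ g s - 1 / ((n : ℝ) + 1) ≤ g u} := fun n => by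
    refine (hclosed _).mem_of_tendsto hq ?_
    filter_upwards [eventually_ge_atTop n] with j hj
    refine ⟨huS _, ?_⟩
    have h1 : (n : ℝ) ≤ φ j := by exact_mod_cast hj.trans (hφ.id_le j)
    have h2 : (1 : ℝ) / ((φ j : ℝ) + 1) ≤ 1 / ((n : ℝ) + 1) := by gcongr
    have := hug (φ j)
    simp only [Function.comp]
    linarith
  have hgq : g s ≤ g q := by
    have h1 : Tendsto (fun n : ℕ => g s - 1 / ((n : ℝ) + 1)) atTop (𝓝 (g s - 0)) :=
      tendsto_const_nhds.sub tendsto_one_div_add_atTop_nhds_zero_nat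
    simpa using le_of_tendsto' h1 fun n => (hmem n).2
  have h1 : Tendsto (fun j => inner ℝ (z - s) (u (φ j) - s)) atTop (𝓝 (inner ℝ (z - s) (q - s))) :=
    tendsto_const_nhds.inner (hq.sub_const s)
  have h2 := ge_of_tendsto' h1 fun j => (hu (φ j)).le
  linarith [hproj q (hmem 0).1 hgq]

/-- Strong convergence of the inexact Halpern proximal point method with variable parameters
bounded away from zero, when the objective has a maximizer. -/
theorem halpern_tendsto_maximizer [FiniteDimensional ℝ E]
    (hclosed : ∀ r, IsClosed {u | u ∈ S ∧ r ≤ g u}) (hconv : ∀ r, Convex ℝ {u | u ∈ S ∧ r ≤ g u})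
    (hε0 : ∀ k, 0 ≤ ε k) (hε : Summable ε) {c₀ : ℝ} (hc₀ : 0 < c₀) (hc : ∀ k, c₀ ≤ c k)
    (hp : ∀ k, IsProxPoint S g (c k) (y k) (p k)) (hw : ∀ k, ‖w k - p k‖ ≤ ε k)
    (hstep : ∀ k : ℕ, y (k + 1) = ((1 : ℝ) / ((k : ℝ) + 2)) • y 0 +
      (((k : ℝ) + 1) / ((k : ℝ) + 2)) • w k)
    {s₀ : E} (hs₀ : s₀ ∈ S) (hmax₀ : ∀ u ∈ S, g u ≤ g s₀) :
    ∃ s ∈ S, (∀ u ∈ S, g u ≤ g s) ∧ Tendsto y atTop (𝓝 s) := by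
  -- The limit is the projection of the anchor `y 0` onto the set of maximizers.
  obtain ⟨s, ⟨hs, hgs⟩, hproj⟩ := exists_norm_eq_iInf_of_complete_convex
    (K := {u | u ∈ S ∧ g s₀ ≤ g u}) ⟨s₀, hs₀, le_rfl⟩ (hclosed _).isComplete (hconv _) (y 0)
  rw [norm_eq_iInf_iff_real_inner_le_zero (hconv _) ⟨hs, hgs⟩] at hproj
  have hmax : ∀ u ∈ S, g u ≤ g s := fun u hu => (hmax₀ u hu).trans hgs
  refine ⟨s, hs, hmax, ?_⟩
  obtain ⟨R, hR⟩ := halpern_norm_sub_le hε0 hε (fun k => hc₀.trans_le (hc k)) hp hw hstep hs hmax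
  have hR0 : 0 ≤ R := (norm_nonneg _).trans (hR 0)
  obtain ⟨τ, hτ0, hτ, hτlim⟩ := exists_tail_of_summable hε0 hε
  have hτanti : Antitone τ := antitone_nat_of_succ_le fun k => by linarith [hτ k, hε0 k]
  have hετ : ∀ k, ε k ≤ τ 0 := fun k => by linarith [hτ k, hτ0 (k + 1), hτanti (Nat.zero_le k)]
  have hybdd : Bornology.IsBounded (Set.range y) := by
    refine (Metric.isBounded_closedBall (x := s) (r := R)).subset ?_
    rintro _ ⟨k, rfl⟩
    simpa [dist_eq_norm] using hR k
  -- Bounds `2 * ‖p k - s‖ + ε k`, the factor of `ε k` in `(‖p k - s‖ + ε k)² - ‖p k - s‖²`.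
  set M := 2 * R + τ 0
  have hM : 0 ≤ M := by have := hτ0 0; positivity
  have hps : ∀ k, ‖p k - s‖ ^ 2 + 2 * c₀ * (g s - g (p k)) ≤ ‖y k - s‖ ^ 2 := fun k => by
    have h1 := (hp k).norm_sub_sq_le (hc₀.trans_le (hc k)) hs
    have h2 := mul_le_mul_of_nonneg_right (hc k) (sub_nonneg.2 (hmax _ (hp k).1))
    linarith
  have hpR : ∀ k, ‖p k - s‖ ≤ R := fun k => by
    have h1 := hps k
    have h2 := mul_nonneg hc₀.le (sub_nonneg.2 (hmax _ (hp k).1))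
    have h3 : ‖p k - s‖ ≤ ‖y k - s‖ :=
      abs_le_of_sq_le_sq' (by linarith) (norm_nonneg _) |>.2
    exact h3.trans (hR k)
  -- With `M * τ k` in the Lyapunov function, the error `(k + 1) * M * ε k`, which need not vanish,
  -- cancels and leaves only `M * τ (k + 1)`.
  set D : ℕ → ℝ := fun k => M * τ (k + 1) + 2 * inner ℝ (y 0 - s) (y (k + 1) - s) -
    2 * c₀ * ((k : ℝ) + 1) * (g s - g (p k))
  have hrec : ∀ k : ℕ, ((k : ℝ) + 2) * (‖y (k + 1) - s‖ ^ 2 + M * τ (k + 1)) ≤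
      ((k : ℝ) + 1) * (‖y k - s‖ ^ 2 + M * τ k) + D k := by
    intro k
    have hk : (0 : ℝ) ≤ k := Nat.cast_nonneg k
    have hw1 : ‖w k - s‖ ^ 2 ≤ ‖p k - s‖ ^ 2 + M * ε k := by
      have h1 : ‖w k - s‖ ≤ ‖p k - s‖ + ε k := by
        have := norm_sub_le_norm_sub_add_norm_sub (w k) (p k) s
        linarith [hw k]
      have h2 : ‖w k - s‖ ^ 2 ≤ (‖p k - s‖ + ε k) ^ 2 := by gcongr
      nlinarith [hpR k, hετ k, hε0 k, mul_le_mul_of_nonneg_right (hpR k) (hε0 k),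
        mul_le_mul_of_nonneg_right (hετ k) (hε0 k)]
    have h3 : ‖y (k + 1) - s‖ ^ 2 ≤ (((k : ℝ) + 1) / ((k : ℝ) + 2)) ^ 2 * ‖w k - s‖ ^ 2 +
        2 * (1 / ((k : ℝ) + 2) * inner ℝ (y 0 - s) (y (k + 1) - s)) := by
      have e := halpern_step_sub hstep s k
      have e' : (((k : ℝ) + 1) / ((k : ℝ) + 2)) • (w k - s) =
        (y (k + 1) - s) - ((1 : ℝ) / ((k : ℝ) + 2)) • (y 0 - s) := by rw [e]; abel
      have h4 : ‖(((k : ℝ) + 1) / ((k : ℝ) + 2)) • (w k - s)‖ ^ 2 =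
        (((k : ℝ) + 1) / ((k : ℝ) + 2)) ^ 2 * ‖w k - s‖ ^ 2 := by
        rw [norm_smul, mul_pow, Real.norm_eq_abs, sq_abs]
      rw [← h4, e', norm_sub_sq_real (y (k + 1) - s), real_inner_smul_right,
        real_inner_comm (y 0 - s)]
      nlinarith [sq_nonneg ‖((1 : ℝ) / ((k : ℝ) + 2)) • (y 0 - s)‖]
    have h5 : (((k : ℝ) + 1) / ((k : ℝ) + 2)) ^ 2 ≤ ((k : ℝ) + 1) / ((k : ℝ) + 2) :=
      pow_le_of_le_one (by positivity) (by rw [div_le_one (by positivity)]; linarith) two_ne_zero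
    have h6 := mul_le_mul_of_nonneg_right h5 (sq_nonneg ‖w k - s‖)
    have h7 : ((k : ℝ) + 2) * ‖y (k + 1) - s‖ ^ 2 ≤ ((k : ℝ) + 1) * ‖w k - s‖ ^ 2 +
        2 * inner ℝ (y 0 - s) (y (k + 1) - s) := by
      have h8 := mul_le_mul_of_nonneg_left (h3.trans (add_le_add_left h6 _))
        (show (0 : ℝ) ≤ (k : ℝ) + 2 by positivity)
      refine h8.trans (le_of_eq ?_)
      field_simp
    have h9 : ‖w k - s‖ ^ 2 ≤ ‖y k - s‖ ^ 2 - 2 * c₀ * (g s - g (p k)) + M * ε k := by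
      linarith [hps k]
    have h10 := mul_le_mul_of_nonneg_left h9 (show (0 : ℝ) ≤ (k : ℝ) + 1 by positivity)
    simp only [D]
    rw [hτ k]
    linarith
  have hεlim := hε.tendsto_atTop_zero
  have hwp : Tendsto (fun k => w k - p k) atTop (𝓝 0) := squeeze_zero_norm hw hεlim
  have hyp : Tendsto (fun k => y (k + 1) - p k) atTop (𝓝 0) := by
    have := hwp.sub (halpern_increment_tendsto_zero hstep hybdd)
    simpa using this
  have hD : ∀ δ > 0, ∀ᶠ k in atTop, D k ≤ δ := by
    intro δ hδ
    obtain ⟨σ, hσ, hnear⟩ := exists_near_maximizer_inner_le hclosed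
      (fun q hq h => hproj q ⟨hq, hgs.trans h⟩) R (show 0 < δ / 4 by linarith)
    have e1 : ∀ᶠ k in atTop, M * τ (k + 1) < δ / 4 := by
      have : Tendsto (fun k => M * τ (k + 1)) atTop (𝓝 (M * 0)) :=
        ((tendsto_add_atTop_iff_nat 1).2 hτlim).const_mul M
      exact this.eventually_lt_const (by simpa using by linarith)
    have e2 : ∀ᶠ k in atTop, inner ℝ (y 0 - s) (y (k + 1) - p k) < δ / 8 := by
      have : Tendsto (fun k => inner ℝ (y 0 - s) (y (k + 1) - p k)) atTop
        (𝓝 (inner ℝ (y 0 - s) 0)) := tendsto_const_nhds.inner hyp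
      exact this.eventually_lt_const (by simpa using by linarith)
    have e3 : ∀ᶠ k : ℕ in atTop, 2 * (‖y 0 - s‖ * R) / (2 * c₀ * σ) ≤ (k : ℝ) :=
      tendsto_natCast_atTop_atTop.eventually_ge_atTop _
    filter_upwards [e1, e2, e3] with k h1 h2 h3
    have hk : (0 : ℝ) ≤ k := Nat.cast_nonneg k
    have hη := sub_nonneg.2 (hmax _ (hp k).1)
    simp only [D]
    -- Either `p k` nearly maximizes and the projection inequality controls the inner product, or
    -- the gap exceeds `σ` and its weight, growing like `k`, outweighs the bounded inner product.
    rcases le_or_gt (g s - g (p k)) σ with h | h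
    · have h4 := hnear _ (hp k).1 (hpR k) h
      have h5 : inner ℝ (y 0 - s) (y (k + 1) - s) =
        inner ℝ (y 0 - s) (y (k + 1) - p k) + inner ℝ (y 0 - s) (p k - s) := by
        rw [← inner_add_right]; congr 1; abel
      have : 0 ≤ 2 * c₀ * ((k : ℝ) + 1) * (g s - g (p k)) := by positivity
      linarith
    · have h4 : inner ℝ (y 0 - s) (y (k + 1) - s) ≤ ‖y 0 - s‖ * R :=
        (real_inner_le_norm _ _).trans (by gcongr; exact hR _)
      rw [div_le_iff₀ (by positivity)] at h3
      have h5 : 2 * c₀ * ((k : ℝ) + 1) * σ ≤ 2 * c₀ * ((k : ℝ) + 1) * (g s - g (p k)) := by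
        gcongr
      have h6 : 0 < c₀ * σ := by positivity
      nlinarith
  have hlim := tendsto_zero_of_halpern_recursion (a := fun k => ‖y k - s‖ ^ 2 + M * τ k)
    (fun k => add_nonneg (sq_nonneg _) (mul_nonneg hM (hτ0 k))) hrec hD
  rw [tendsto_iff_norm_sub_tendsto_zero]
  have h1 : Tendsto (fun k => ‖y k - s‖ ^ 2) atTop (𝓝 0) :=
    squeeze_zero (fun k => sq_nonneg _)
      (fun k => le_add_of_nonneg_right (mul_nonneg hM (hτ0 k))) hlim
  simpa [Real.sqrt_sq] using h1.sqrt

/-- If the iterates of the inexact Halpern proximal point method are bounded, then the objective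
has a maximizer and the iterates converge to one. -/
theorem halpern_tendsto_of_isBounded [FiniteDimensional ℝ E]
    (hclosed : ∀ r, IsClosed {u | u ∈ S ∧ r ≤ g u}) (hconv : ∀ r, Convex ℝ {u | u ∈ S ∧ r ≤ g u})
    (hε0 : ∀ k, 0 ≤ ε k) (hε : Summable ε) {c₀ : ℝ} (hc₀ : 0 < c₀) (hc : ∀ k, c₀ ≤ c k)
    (hp : ∀ k, IsProxPoint S g (c k) (y k) (p k)) (hw : ∀ k, ‖w k - p k‖ ≤ ε k)
    (hstep : ∀ k : ℕ, y (k + 1) = ((1 : ℝ) / ((k : ℝ) + 2)) • y 0 +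
      (((k : ℝ) + 1) / ((k : ℝ) + 2)) • w k)
    (hy : Bornology.IsBounded (Set.range y))
    (hlocal : ∀ B : Set E, IsCompact B → (S ∩ B).Nonempty → ∃ s ∈ S ∩ B, ∀ u ∈ S ∩ B, g u ≤ g s) :
    ∃ s ∈ S, (∀ u ∈ S, g u ≤ g s) ∧ Tendsto y atTop (𝓝 s) := by
  have : ProperSpace E := FiniteDimensional.proper ℝ E
  have hwp : Tendsto (fun k => w k - p k) atTop (𝓝 0) :=
    squeeze_zero_norm hw hε.tendsto_atTop_zero
  have hinc := halpern_increment_tendsto_zero hstep hy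
  have hpy : Tendsto (fun k => p k - y (k + 1)) atTop (𝓝 0) := by
    have := hinc.sub hwp
    simpa using this
  obtain ⟨R₁, hR₁⟩ := hy.exists_norm_le
  obtain ⟨R₂, hR₂⟩ := (Metric.isBounded_range_of_tendsto _ hpy).exists_norm_le
  have hpB : ∀ k, p k ∈ Metric.closedBall (0 : E) (R₁ + R₂) := fun k => by
    have h1 := hR₁ _ (Set.mem_range_self (k + 1))
    have h2 := hR₂ _ (Set.mem_range_self k)
    have h3 := norm_add_le (p k - y (k + 1)) (y (k + 1))
    rw [sub_add_cancel] at h3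
    rw [mem_closedBall_zero_iff]; linarith
  set B := Metric.closedBall (0 : E) (R₁ + R₂)
  have hset : ∀ r, {u | u ∈ S ∩ B ∧ r ≤ g u} = {u | u ∈ S ∧ r ≤ g u} ∩ B := fun r => by
    ext u; simp only [Set.mem_ofPred_eq, Set.mem_inter_iff]; tauto
  -- No global maximizer is known yet. The proximal inequalities persist on `S ∩ B`, where one
  -- exists by compactness, so the iterates converge to a maximizer over `S ∩ B`.
  obtain ⟨s₀, hs₀, hmax₀⟩ := hlocal B (isCompact_closedBall _ _) ⟨p 0, (hp 0).1, hpB 0⟩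
  obtain ⟨s, hs, hmax, hlim⟩ := halpern_tendsto_maximizer (S := S ∩ B)
    (fun r => by rw [hset]; exact (hclosed r).inter Metric.isClosed_closedBall)
    (fun r => by rw [hset]; exact (hconv r).inter (convex_closedBall _ _))
    hε0 hε hc₀ hc (fun k => ⟨⟨(hp k).1, hpB k⟩, fun u hu => (hp k).2 u hu.1⟩) hw hstep hs₀ hmax₀
  refine ⟨s, hs.1, fun u hu => ?_, hlim⟩
  have hyl := (tendsto_add_atTop_iff_nat 1).2 hlim
  have hpl : Tendsto p atTop (𝓝 s) := by simpa using hpy.add hyl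
  have hin : Tendsto (fun k => g s + ‖u - p k‖ * ‖p k - y k‖ / c₀) atTop
      (𝓝 (g s + ‖u - s‖ * ‖s - s‖ / c₀)) :=
    tendsto_const_nhds.add (((tendsto_const_nhds.sub hpl).norm.mul (hpl.sub hlim).norm).div_const _)
  -- For `u` anywhere in `S`, the proximal inequality passes to the limit because `p k - y k → 0`;
  -- hence the local maximizer is global.
  have h := ge_of_tendsto' hin (b := g u) fun k => by
    refine ((hp k).2 u hu).trans (add_le_add (hmax _ ⟨(hp k).1, hpB k⟩) ?_)
    have hck := hc₀.trans_le (hc k)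
    calc inner ℝ (u - p k) (p k - y k) / c k ≤ ‖u - p k‖ * ‖p k - y k‖ / c k := by
          gcongr; exact real_inner_le_norm _ _
      _ ≤ ‖u - p k‖ * ‖p k - y k‖ / c₀ := by gcongr; exact hc k
  simpa using h

end Halpern
end

/-! ### The dual function -/

noncomputable section

theorem EReal.limsup_coe_le_iff {a : ℕ → ℝ} {b : ℝ} :
    limsup (fun k => (a k : EReal)) atTop ≤ (b : EReal) ↔ ∀ z > b, ∀ᶠ k in atTop, a k < z := by
  constructor
  · intro h z hz
    have := eventually_lt_of_limsup_lt (h.trans_lt (EReal.coe_lt_coe_iff.2 hz))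
    simpa using this
  · intro h
    by_contra! hlt
    obtain ⟨z, hz1, hz2⟩ := EReal.lt_iff_exists_real_btwn.1 hlt
    refine hz2.not_ge (limsup_le_of_le (h := ?_))
    filter_upwards [h z (EReal.coe_lt_coe_iff.1 hz1)] with k hk
    exact EReal.coe_le_coe_iff.2 hk.le

namespace ConvexProgram

variable {n m : ℕ} (P : ConvexProgram n m)

/-- The ordinary Lagrangian. -/
def lagrangian (x : EuclideanSpace ℝ (Fin n)) (u : EuclideanSpace ℝ (Fin m)) : ℝ :=
  P.f₀ x + ∑ j, u j * P.f j x

/-- The real-valued expression of the augmented Lagrangian. -/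
def augReal (x : EuclideanSpace ℝ (Fin n)) (y : EuclideanSpace ℝ (Fin m)) (c : ℝ) : ℝ :=
  P.f₀ x + 1 / (2 * c) * (‖P.multiplier x y c‖ ^ 2 - ‖y‖ ^ 2)

/-- The nonnegative vectors at which the dual function is finite. -/
def dualDomain : Set (EuclideanSpace ℝ (Fin m)) :=
  {u | (∀ i, 0 ≤ u i) ∧ P.dualFun u ≠ ⊥}

/-- The real-valued dual function. -/
def dualVal (u : EuclideanSpace ℝ (Fin m)) : ℝ := (P.dualFun u).toReal

variable {P}

theorem multiplier_nonneg (x : EuclideanSpace ℝ (Fin n)) (y : EuclideanSpace ℝ (Fin m)) (c : ℝ)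
    (i : Fin m) : 0 ≤ P.multiplier x y c i := le_max_right _ _

theorem isClosed_orthant : IsClosed {u : EuclideanSpace ℝ (Fin m) | ∀ i, 0 ≤ u i} := by
  have : {u : EuclideanSpace ℝ (Fin m) | ∀ i, 0 ≤ u i} = ⋂ i, {u | 0 ≤ u i} := by
    ext; simp
  rw [this]
  exact isClosed_iInter fun i => isClosed_le continuous_const (by fun_prop)

theorem continuous_lagrangian (x : EuclideanSpace ℝ (Fin n)) : Continuous (P.lagrangian x) := by
  unfold lagrangian; fun_prop

theorem le_dualFun_iff {r : ℝ} {u : EuclideanSpace ℝ (Fin m)} :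
    (r : EReal) ≤ P.dualFun u ↔ ∀ x ∈ P.C, r ≤ P.lagrangian x u := by
  simp only [dualFun, le_iInf_iff, EReal.coe_le_coe_iff]; rfl

theorem dualFun_le {x : EuclideanSpace ℝ (Fin n)} (hx : x ∈ P.C) (u : EuclideanSpace ℝ (Fin m)) :
    P.dualFun u ≤ (P.lagrangian x u : EReal) := iInf₂_le x hx

theorem dualFun_ne_top (u : EuclideanSpace ℝ (Fin m)) : P.dualFun u ≠ ⊤ := by
  obtain ⟨x, hx⟩ := P.nonempty_C
  exact ((dualFun_le hx u).trans_lt (EReal.coe_lt_top _)).ne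

theorem coe_dualVal {u : EuclideanSpace ℝ (Fin m)} (hu : u ∈ P.dualDomain) :
    (P.dualVal u : EReal) = P.dualFun u := EReal.coe_toReal (dualFun_ne_top u) hu.2

/-- Exhibits superlevel sets as intersections of half-spaces, whence closedness and convexity.
Membership in `dualDomain` is essential, as `toReal` sends `⊥` to `0`. -/
theorem mem_dualDomain_and_le_iff {r : ℝ} {u : EuclideanSpace ℝ (Fin m)} :
    (u ∈ P.dualDomain ∧ r ≤ P.dualVal u) ↔
      (∀ i, 0 ≤ u i) ∧ ∀ x ∈ P.C, r ≤ P.lagrangian x u := by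
  rw [← le_dualFun_iff]
  constructor
  · rintro ⟨h1, h2⟩
    exact ⟨h1.1, by rw [← coe_dualVal h1]; exact EReal.coe_le_coe_iff.2 h2⟩
  · rintro ⟨h1, h2⟩
    have h3 : u ∈ P.dualDomain := ⟨h1, ((EReal.bot_lt_coe r).trans_le h2).ne'⟩
    rw [← coe_dualVal h3] at h2
    exact ⟨h3, EReal.coe_le_coe_iff.1 h2⟩

theorem dualVal_le {x : EuclideanSpace ℝ (Fin n)} (hx : x ∈ P.C) {u : EuclideanSpace ℝ (Fin m)}
    (hu : u ∈ P.dualDomain) : P.dualVal u ≤ P.lagrangian x u :=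
  (mem_dualDomain_and_le_iff.1 ⟨hu, le_rfl⟩).2 x hx

theorem isClosed_dual_superlevel (r : ℝ) : IsClosed {u | u ∈ P.dualDomain ∧ r ≤ P.dualVal u} := by
  have : {u | u ∈ P.dualDomain ∧ r ≤ P.dualVal u} =
      {u | ∀ i, 0 ≤ u i} ∩ ⋂ x ∈ P.C, {u | r ≤ P.lagrangian x u} := by
    ext u
    simp only [Set.mem_ofPred_eq, mem_dualDomain_and_le_iff, Set.mem_inter_iff, Set.mem_iInter]
  rw [this]
  exact isClosed_orthant.inter (isClosed_biInter fun x _ =>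
    isClosed_le continuous_const (continuous_lagrangian x))

theorem lagrangian_combo (x : EuclideanSpace ℝ (Fin n)) (u v : EuclideanSpace ℝ (Fin m))
    {a b : ℝ} (hab : a + b = 1) :
    P.lagrangian x (a • u + b • v) = a * P.lagrangian x u + b * P.lagrangian x v := by
  have h : b = 1 - a := by linarith
  simp only [lagrangian, PiLp.add_apply, PiLp.smul_apply, smul_eq_mul, add_mul,
    Finset.sum_add_distrib, mul_assoc, ← Finset.mul_sum]
  rw [h]; ring

theorem convex_dual_superlevel (r : ℝ) : Convex ℝ {u | u ∈ P.dualDomain ∧ r ≤ P.dualVal u} := by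
  intro u hu v hv a b ha hb hab
  simp only [Set.mem_ofPred_eq, mem_dualDomain_and_le_iff] at hu hv ⊢
  refine ⟨fun i => ?_, fun x hx => ?_⟩
  · have h1 := mul_nonneg ha (hu.1 i)
    have h2 := mul_nonneg hb (hv.1 i)
    simpa using add_nonneg h1 h2
  · rw [lagrangian_combo x u v hab]
    have h1 := mul_le_mul_of_nonneg_left (hu.2 x hx) ha
    have h2 := mul_le_mul_of_nonneg_left (hv.2 x hx) hb
    calc r = a * r + b * r := by rw [← add_mul, hab, one_mul]
      _ ≤ _ := add_le_add h1 h2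

theorem upperSemicontinuous_dualFun : UpperSemicontinuous P.dualFun :=
  upperSemicontinuous_biInf fun x _ =>
    (continuous_coe_real_ereal.comp (continuous_lagrangian x)).upperSemicontinuous

theorem nonempty_dualDomain (hD : ⊥ < P.dualSup) : P.dualDomain.Nonempty := by
  by_contra h
  refine hD.ne' (le_bot_iff.1 (iSup₂_le fun u hu => ?_))
  by_contra h'
  exact h ⟨u, hu, fun h0 => h' h0.le⟩

theorem isDualOptimal_iff (hS : P.dualDomain.Nonempty) {s : EuclideanSpace ℝ (Fin m)} :
    P.IsDualOptimal s ↔ s ∈ P.dualDomain ∧ ∀ u ∈ P.dualDomain, P.dualVal u ≤ P.dualVal s := by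
  constructor
  · rintro ⟨h1, h2⟩
    obtain ⟨u₀, hu₀⟩ := hS
    have hs : s ∈ P.dualDomain := ⟨h1, fun h => hu₀.2 (le_bot_iff.1 (h ▸ h2 u₀ hu₀.1))⟩
    refine ⟨hs, fun u hu => ?_⟩
    rw [← EReal.coe_le_coe_iff, coe_dualVal hu, coe_dualVal hs]
    exact h2 u hu.1
  · rintro ⟨hs, h2⟩
    refine ⟨hs.1, fun u hu => ?_⟩
    by_cases hb : P.dualFun u = ⊥
    · simp [hb]
    · rw [← coe_dualVal hs, ← coe_dualVal ⟨hu, hb⟩]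
      exact EReal.coe_le_coe_iff.2 (h2 u ⟨hu, hb⟩)

theorem IsDualOptimal.dualFun_eq {s : EuclideanSpace ℝ (Fin m)} (hs : P.IsDualOptimal s) :
    P.dualFun s = P.dualSup :=
  le_antisymm (le_iSup₂ (f := fun u (_ : ∀ i, 0 ≤ u i) => P.dualFun u) s hs.1) (iSup₂_le hs.2)

/-- `dualDomain` need not be closed, so the `EReal`-valued function is maximized over the closed
orthant instead; a maximizer cannot have value `⊥`. -/
theorem exists_dualVal_max_on_compact {B : Set (EuclideanSpace ℝ (Fin m))} (hB : IsCompact B)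
    (hne : (P.dualDomain ∩ B).Nonempty) :
    ∃ s ∈ P.dualDomain ∩ B, ∀ u ∈ P.dualDomain ∩ B, P.dualVal u ≤ P.dualVal s := by
  obtain ⟨u₀, hu₀, hu₀B⟩ := hne
  obtain ⟨s, ⟨hs, hsB⟩, hmax⟩ := (upperSemicontinuous_dualFun (P := P)).upperSemicontinuousOn _
    |>.exists_isMaxOn (s := {u : EuclideanSpace ℝ (Fin m) | ∀ i, 0 ≤ u i} ∩ B) ⟨u₀, hu₀.1, hu₀B⟩ (hB.inter_left isClosed_orthant)
  have hs' : s ∈ P.dualDomain := ⟨hs, fun h => hu₀.2 (le_bot_iff.1 (h ▸ hmax ⟨hu₀.1, hu₀B⟩))⟩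
  refine ⟨s, ⟨hs', hsB⟩, fun u hu => ?_⟩
  rw [← EReal.coe_le_coe_iff, coe_dualVal hu.1, coe_dualVal hs']
  exact hmax ⟨hu.1.1, hu.2⟩

theorem convexOn_lagrangian {u : EuclideanSpace ℝ (Fin m)} (hu : ∀ i, 0 ≤ u i) :
    ConvexOn ℝ P.C fun x => P.lagrangian x u := by
  have h : ∀ s : Finset (Fin m), ConvexOn ℝ Set.univ fun x => ∑ j ∈ s, u j * P.f j x := by
    intro s
    induction s using Finset.induction_on with
    | empty => simpa using convexOn_const (0 : ℝ) convex_univ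
    | insert j s hj ih =>
      simp only [Finset.sum_insert hj]
      exact ((P.convexOn_f j).smul (hu j)).add ih
  exact (P.convexOn_f₀.add (h _)).subset (Set.subset_univ _) P.convex_C

/-! ### The augmented Lagrangian as a proximal envelope -/

section Aug

variable {c : ℝ} (x : EuclideanSpace ℝ (Fin n)) (y : EuclideanSpace ℝ (Fin m))

/-- Completing the square in each coordinate; the remainder expresses strong concavity in `u`, with
equality at the projection by `lagrangian_multiplier`. -/
theorem lagrangian_sub_le_augReal (hc : 0 < c) {u : EuclideanSpace ℝ (Fin m)}
    (hu : ∀ i, 0 ≤ u i) :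
    P.lagrangian x u - ‖u - y‖ ^ 2 / (2 * c) ≤
      P.augReal x y c - 1 / (2 * c) * ‖u - P.multiplier x y c‖ ^ 2 := by
  have key : 2 * c * (∑ j, u j * P.f j x) - ‖u - y‖ ^ 2 ≤
      ‖P.multiplier x y c‖ ^ 2 - ‖y‖ ^ 2 - ‖u - P.multiplier x y c‖ ^ 2 := by
    simp only [EuclideanSpace.real_norm_sq_eq, Finset.mul_sum, ← Finset.sum_sub_distrib]
    refine Finset.sum_le_sum fun i _ => ?_
    simp only [PiLp.sub_apply, multiplier]
    nlinarith [mul_le_mul_of_nonneg_left (le_max_left (y i + c * P.f i x) 0) (hu i)]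
  have h : P.lagrangian x u - ‖u - y‖ ^ 2 / (2 * c) =
      P.f₀ x + (2 * c * (∑ j, u j * P.f j x) - ‖u - y‖ ^ 2) / (2 * c) := by
    unfold lagrangian; field_simp; ring
  have h' : P.augReal x y c - 1 / (2 * c) * ‖u - P.multiplier x y c‖ ^ 2 = P.f₀ x +
      (‖P.multiplier x y c‖ ^ 2 - ‖y‖ ^ 2 - ‖u - P.multiplier x y c‖ ^ 2) / (2 * c) := by
    unfold augReal; field_simp; ring
  rw [h, h']
  gcongr

theorem lagrangian_multiplier (hc : 0 < c) :
    P.lagrangian x (P.multiplier x y c) - ‖P.multiplier x y c - y‖ ^ 2 / (2 * c) =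
      P.augReal x y c := by
  have key : 2 * c * (∑ j, P.multiplier x y c j * P.f j x) - ‖P.multiplier x y c - y‖ ^ 2 =
      ‖P.multiplier x y c‖ ^ 2 - ‖y‖ ^ 2 := by
    simp only [EuclideanSpace.real_norm_sq_eq, Finset.mul_sum, ← Finset.sum_sub_distrib]
    refine Finset.sum_congr rfl fun i _ => ?_
    simp only [PiLp.sub_apply, multiplier]
    rcases max_cases (y i + c * P.f i x) 0 with ⟨h, -⟩ | ⟨h, -⟩ <;> rw [h] <;> ring
  unfold augReal
  rw [← key]
  unfold lagrangian; field_simp; ring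

/-- The multiplier step of the augmented Lagrangian method is an inexact proximal step for the
dual problem. -/
theorem exists_isProxPoint (hS : P.dualDomain.Nonempty) (hc : 0 < c) :
    ∃ p, IsProxPoint P.dualDomain P.dualVal c y p ∧ ∀ x ∈ P.C, ∀ e,
      (∀ z ∈ P.C, P.augReal x y c ≤ P.augReal z y c + e) →
        ‖P.multiplier x y c - p‖ ^ 2 ≤ 2 * c * e ∧ P.augReal x y c ≤ P.dualVal p + e := by
  obtain ⟨u₀, hu₀⟩ := hS
  set A := (fun z => P.augReal z y c) '' P.C
  have hA : A.Nonempty := P.nonempty_C.image _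
  have hAb : BddBelow A := by
    refine ⟨P.dualVal u₀ - ‖u₀ - y‖ ^ 2 / (2 * c), ?_⟩
    rintro _ ⟨z, hz, rfl⟩
    have h1 := lagrangian_sub_le_augReal (P := P) z y hc hu₀.1
    have h2 := dualVal_le hz hu₀
    have h3 : 0 ≤ 1 / (2 * c) * ‖u₀ - P.multiplier z y c‖ ^ 2 := by positivity
    simp only
    linarith
  set r := sInf A
  have hr : ∀ z ∈ P.C, r ≤ P.augReal z y c := fun z hz => csInf_le hAb ⟨z, hz, rfl⟩
  have hr' : ∀ δ > 0, ∃ z ∈ P.C, P.augReal z y c < r + δ := fun δ hδ => by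
    obtain ⟨_, ⟨z, hz, rfl⟩, h⟩ := exists_lt_of_csInf_lt hA (show sInf A < r + δ by linarith)
    exact ⟨z, hz, h⟩
  obtain ⟨p, hp, hpr⟩ := exists_dual_point_of_strongly_concave P.convex_C isClosed_orthant
    (h := fun x u => P.lagrangian x u - ‖u - y‖ ^ 2 / (2 * c)) (κ := 1 / (2 * c))
    (L := fun x => P.augReal x y c) (Y := fun x => P.multiplier x y c) (by positivity)
    (fun u hu => (convexOn_lagrangian hu).sub (concaveOn_const _ P.convex_C))
    (fun x => (continuous_lagrangian x).sub (by fun_prop))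
    (fun x => multiplier_nonneg x y c) (fun x => lagrangian_multiplier x y hc)
    (fun x u hu => lagrangian_sub_le_augReal x y hc hu) hr hr'
  obtain ⟨hpS, hpv⟩ := mem_dualDomain_and_le_iff.2
    ⟨hp, fun x hx => show r + ‖p - y‖ ^ 2 / (2 * c) ≤ P.lagrangian x p by linarith [hpr x hx]⟩
  -- The strong concavity remainder at `u = p` turns suboptimality in `x` into distance from `p`.
  have hY : ∀ z ∈ P.C, ‖P.multiplier z y c - p‖ ^ 2 ≤ 2 * c * (P.augReal z y c - r) := by
    intro z hz
    have h1 := lagrangian_sub_le_augReal (P := P) z y hc hp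
    have h2 := hpr z hz
    have h3 : 1 / (2 * c) * ‖p - P.multiplier z y c‖ ^ 2 ≤ P.augReal z y c - r := by linarith
    rw [one_div, inv_mul_le_iff₀ (by positivity)] at h3
    rwa [norm_sub_rev]
  refine ⟨p, ⟨hpS, fun u hu => ?_⟩, fun x hx e he => ?_⟩
  -- Along a minimizing sequence the multipliers tend to `p`; the retained term `‖u - p‖²` combines
  -- with `‖u - y‖²` into the inner product.
  · choose z hz hzr using fun j : ℕ => hr' (1 / ((j : ℝ) + 1)) (by positivity)
    have hd := tendsto_one_div_add_atTop_nhds_zero_nat (𝕜 := ℝ)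
    have hYlim : Tendsto (fun j => P.multiplier (z j) y c) atTop (𝓝 p) := by
      rw [tendsto_iff_norm_sub_tendsto_zero]
      have h1 : Tendsto (fun j => ‖P.multiplier (z j) y c - p‖ ^ 2) atTop (𝓝 0) := by
        refine squeeze_zero (fun _ => sq_nonneg _) (g := fun j : ℕ => 2 * c * (1 / ((j : ℝ) + 1)))
          (fun j => (hY _ (hz j)).trans ?_) (by simpa using hd.const_mul (2 * c))
        gcongr; linarith [hzr j]
      simpa [Real.sqrt_sq] using h1.sqrt
    have h1 : Tendsto (fun j : ℕ => r + 1 / ((j : ℝ) + 1) -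
        1 / (2 * c) * ‖u - P.multiplier (z j) y c‖ ^ 2 + ‖u - y‖ ^ 2 / (2 * c)) atTop
        (𝓝 (r + 0 - 1 / (2 * c) * ‖u - p‖ ^ 2 + ‖u - y‖ ^ 2 / (2 * c))) :=
      ((hd.const_add r).sub (((hYlim.const_sub u).norm.pow 2).const_mul _)).add_const _
    have h2 := ge_of_tendsto' h1 (b := P.dualVal u) fun j => by
      have := dualVal_le (hz j) hu
      have := lagrangian_sub_le_augReal (P := P) (z j) y hc hu.1
      have := hzr j
      linarith
    have h3 : ‖u - y‖ ^ 2 = ‖u - p‖ ^ 2 + 2 * inner ℝ (u - p) (p - y) + ‖p - y‖ ^ 2 := by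
      rw [← norm_add_sq_real, sub_add_sub_cancel]
    have h4 : r + 0 - 1 / (2 * c) * ‖u - p‖ ^ 2 + ‖u - y‖ ^ 2 / (2 * c) =
        r + ‖p - y‖ ^ 2 / (2 * c) + inner ℝ (u - p) (p - y) / c := by
      rw [h3]; field_simp; ring
    linarith
  · have h1 : P.augReal x y c - e ≤ r := by
      refine le_csInf hA ?_
      rintro _ ⟨z, hz, rfl⟩
      have := he z hz
      simp only
      linarith
    have h2 : 0 ≤ ‖p - y‖ ^ 2 / (2 * c) := by positivity
    refine ⟨(hY x hx).trans ?_, by linarith⟩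
    gcongr; linarith

end Aug

/-! ### Weak duality in the limit and the Slater condition -/

theorem dualSup_le_asympInf : P.dualSup ≤ P.asympInf := by
  refine iSup₂_le fun u hu => le_iInf₂ fun x hx => ?_
  by_contra! hlt
  obtain ⟨z₁, hz₁, hz₁'⟩ := EReal.lt_iff_exists_real_btwn.1 hlt
  obtain ⟨z₂, hz₂, hz₂'⟩ := EReal.lt_iff_exists_real_btwn.1 hz₁'
  have h12 : z₁ < z₂ := EReal.coe_lt_coe_iff.1 hz₂
  have hU : 0 < ∑ j, u j + 1 := by
    have := Finset.sum_nonneg fun j (_ : j ∈ Finset.univ) => hu j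
    linarith
  have e1 : ∀ᶠ k in atTop, P.f₀ (x k) < z₁ := by
    simpa using eventually_lt_of_limsup_lt hz₁
  -- The tolerance keeps `∑ j, u j * P.f j (x k)` at most `z₂ - z₁`; the `+ 1` avoids division by
  -- zero when `u = 0`.
  have e2 : ∀ᶠ k in atTop, ∀ j, P.f j (x k) < (z₂ - z₁) / (∑ j, u j + 1) :=
    eventually_all.2 fun j => EReal.limsup_coe_le_iff.1 (hx.2 j) _ (div_pos (by linarith) hU)
  obtain ⟨k, h1, h2⟩ := (e1.and e2).exists
  have h3 : ∑ j, u j * P.f j (x k) ≤ (∑ j, u j) * ((z₂ - z₁) / (∑ j, u j + 1)) := by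
    rw [Finset.sum_mul]
    exact Finset.sum_le_sum fun j _ => mul_le_mul_of_nonneg_left (h2 j).le (hu j)
  have h4 : (∑ j, u j) * ((z₂ - z₁) / (∑ j, u j + 1)) ≤ z₂ - z₁ := by
    rw [mul_div_assoc', div_le_iff₀ hU]; nlinarith
  have h5 := le_dualFun_iff.1 hz₂'.le _ (hx.1 k)
  unfold lagrangian at h5
  linarith

theorem asympInf_le_primalInf : P.asympInf ≤ P.primalInf := by
  refine le_iInf₂ fun z hz => (iInf₂_le (fun _ => z) ⟨fun _ => hz.1, fun i => ?_⟩).trans ?_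
  · rw [limsup_const]
  · rw [limsup_const]; exact_mod_cast hz.2 i

/-- Moving a late iterate by a fraction `t` towards the Slater point absorbs violations below `t *
-P.f j s`; then `t → 0`. -/
theorem primalInf_le_of_slater (hsl : P.Slater) {x : ℕ → EuclideanSpace ℝ (Fin n)}
    (hx : P.AsympFeasible x) {v : ℝ} (hv : ∀ z > v, ∀ᶠ k in atTop, P.f₀ (x k) < z) :
    P.primalInf ≤ v := by
  obtain ⟨s, hsC, hs⟩ := hsl
  have key : ∀ t : ℝ, 0 < t → t < 1 →
      P.primalInf ≤ (((1 - t) * (v + t) + t * P.f₀ s : ℝ) : EReal) := by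
    intro t ht0 ht1
    have e1 := hv (v + t) (by linarith)
    have e2 : ∀ᶠ k in atTop, ∀ j, P.f j (x k) < t * -P.f j s :=
      eventually_all.2 fun j => EReal.limsup_coe_le_iff.1 (hx.2 j) _
        (mul_pos ht0 (neg_pos.2 (hs j)))
    obtain ⟨k, h1, h2⟩ := (e1.and e2).exists
    have h1t : 0 ≤ 1 - t := by linarith
    have hfeas : P.Feasible ((1 - t) • x k + t • s) := by
      refine ⟨P.convex_C (hx.1 k) hsC h1t ht0.le (by ring), fun i => ?_⟩
      have h3 : P.f i ((1 - t) • x k + t • s) ≤ (1 - t) * P.f i (x k) + t * P.f i s :=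
        (P.convexOn_f i).2 (Set.mem_univ _) (Set.mem_univ _) h1t ht0.le (by ring)
      have h4 := mul_le_mul_of_nonneg_left (h2 i).le h1t
      nlinarith [hs i, mul_pos ht0 (neg_pos.2 (hs i))]
    refine (iInf₂_le _ hfeas).trans (EReal.coe_le_coe_iff.2 ?_)
    have h3 : P.f₀ ((1 - t) • x k + t • s) ≤ (1 - t) * P.f₀ (x k) + t * P.f₀ s :=
      P.convexOn_f₀.2 (Set.mem_univ _) (Set.mem_univ _) h1t ht0.le (by ring)
    have h4 := mul_le_mul_of_nonneg_left h1.le h1t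
    linarith
  have hlim : Tendsto (fun t : ℝ => (((1 - t) * (v + t) + t * P.f₀ s : ℝ) : EReal)) (𝓝[>] 0)
      (𝓝 (v : EReal)) := by
    have h1 : Continuous fun t : ℝ => (((1 - t) * (v + t) + t * P.f₀ s : ℝ) : EReal) :=
      continuous_coe_real_ereal.comp (by fun_prop)
    have h2 := (h1.tendsto 0).mono_left (nhdsWithin_le_nhds (s := Set.Ioi 0))
    simpa using h2
  refine ge_of_tendsto hlim ?_
  filter_upwards [Ioo_mem_nhdsGT (show (0 : ℝ) < 1 by norm_num)] with t ht
  exact key t ht.1 ht.2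

/-- At a Slater point every term of `∑ j, u j * P.f j x` is nonpositive, so a lower bound on the
dual value bounds each coordinate of `u`. -/
theorem exists_isDualOptimal_of_slater (hS : P.dualDomain.Nonempty) (hsl : P.Slater) :
    ∃ s, P.IsDualOptimal s := by
  obtain ⟨x, hxC, hx⟩ := hsl
  obtain ⟨u₀, hu₀⟩ := hS
  set B := {u | u ∈ P.dualDomain ∧ P.dualVal u₀ ≤ P.dualVal u}
  have hcoord : ∀ u ∈ B, ∀ i, u i * -P.f i x ≤ P.f₀ x - P.dualVal u₀ := by
    intro u hu i
    have h1 := hu.2.trans (dualVal_le hxC hu.1)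
    have h2 : u i * -P.f i x ≤ ∑ j, u j * -P.f j x :=
      Finset.single_le_sum (f := fun j => u j * -P.f j x)
        (fun j _ => mul_nonneg (hu.1.1 j) (neg_pos.2 (hx j)).le) (Finset.mem_univ i)
    simp only [mul_neg, Finset.sum_neg_distrib] at h2 ⊢
    unfold lagrangian at h1
    linarith
  have hBb : Bornology.IsBounded B := by
    refine isBounded_iff_forall_norm_le.2
      ⟨∑ i, (P.f₀ x - P.dualVal u₀) / -P.f i x, fun u hu => ?_⟩
    have h0 : ‖u‖ ≤ ∑ i, |u i| := by
      rw [EuclideanSpace.norm_eq]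
      refine Real.sqrt_le_iff.2 ⟨Finset.sum_nonneg fun _ _ => abs_nonneg _, ?_⟩
      simp only [Real.norm_eq_abs]
      exact Finset.sum_sq_le_sq_sum_of_nonneg fun _ _ => abs_nonneg _
    refine h0.trans (Finset.sum_le_sum fun i _ => ?_)
    rw [abs_of_nonneg (hu.1.1 i), le_div_iff₀ (neg_pos.2 (hx i))]
    exact hcoord u hu i
  have hBc : IsCompact B := Metric.isCompact_of_isClosed_isBounded (isClosed_dual_superlevel _) hBb
  obtain ⟨s, hs, hmax⟩ := exists_dualVal_max_on_compact hBc ⟨u₀, hu₀, hu₀, le_rfl⟩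
  refine ⟨s, (isDualOptimal_iff ⟨u₀, hu₀⟩).2 ⟨hs.1, fun u hu => ?_⟩⟩
  rcases le_total (P.dualVal u₀) (P.dualVal u) with h | h
  · exact hmax u ⟨hu, hu, h⟩
  · exact h.trans hs.2.2

/-- If one nonempty joint sublevel set is bounded, then so are all larger ones. -/
theorem isBounded_relaxed_sublevel {α : ℝ}
    (hne : {z | P.Feasible z ∧ P.f₀ z ≤ α}.Nonempty)
    (hb : Bornology.IsBounded {z | P.Feasible z ∧ P.f₀ z ≤ α}) (M : ℝ) :
    Bornology.IsBounded {z | z ∈ P.C ∧ (∀ i, P.f i z ≤ M) ∧ P.f₀ z ≤ α + M} := by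
  obtain ⟨z, hz, hzα⟩ := hne
  obtain ⟨R, hR⟩ := hb.exists_norm_le
  have hzR := hR z ⟨hz, hzα⟩
  have hR0 : 0 ≤ R := (norm_nonneg _).trans hzR
  by_contra hunb
  have hfar : ∀ j : ℕ, ∃ w ∈ {z | z ∈ P.C ∧ (∀ i, P.f i z ≤ M) ∧ P.f₀ z ≤ α + M},
      (2 * R + 1) * ((j : ℝ) + 1) < ‖w - z‖ := by
    intro j
    by_contra! hcon
    refine hunb ((Metric.isBounded_closedBall (x := z) (r := (2 * R + 1) * ((j : ℝ) + 1))).subset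
      fun w hw => ?_)
    simpa [dist_eq_norm] using hcon w hw
  choose w hw hwn using hfar
  -- Puts `q j` at distance exactly `2 * R + 1` from `z`, while the original sublevel set lies
  -- within `2 * R` of `z`. As `t j → 0`, the excess `t j * M` disappears and the limit lies in that
  -- set.
  set t : ℕ → ℝ := fun j => (2 * R + 1) / ‖w j - z‖
  have hpos : ∀ j, 0 < ‖w j - z‖ := fun j => lt_trans (by positivity) (hwn j)
  have ht0 : ∀ j, 0 < t j := fun j => div_pos (by linarith) (hpos j)
  have htle : ∀ j : ℕ, t j ≤ 1 / ((j : ℝ) + 1) := fun j => by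
    simp only [t]
    rw [div_le_div_iff₀ (hpos j) (by positivity)]
    linarith [hwn j]
  have ht1 : ∀ j, t j ≤ 1 := fun j => (htle j).trans (by
    rw [div_le_one (by positivity)]; linarith [Nat.cast_nonneg (α := ℝ) j])
  have htlim : Tendsto t atTop (𝓝 0) :=
    squeeze_zero (fun j => (ht0 j).le) htle tendsto_one_div_add_atTop_nhds_zero_nat
  set q : ℕ → EuclideanSpace ℝ (Fin n) := fun j => (1 - t j) • z + t j • w j
  have hqn : ∀ j, ‖q j - z‖ = 2 * R + 1 := fun j => by
    have : q j - z = t j • (w j - z) := by simp only [q]; module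
    rw [this, norm_smul, Real.norm_of_nonneg (ht0 j).le]
    exact div_mul_cancel₀ _ (hpos j).ne'
  obtain ⟨q₀, -, φ, hφ, hq⟩ := tendsto_subseq_of_bounded
    (Metric.isBounded_closedBall (x := z) (r := 2 * R + 1)) (x := q)
    (fun j => by simp [dist_eq_norm, hqn j])
  have hq₀n : ‖q₀ - z‖ = 2 * R + 1 := by
    have h1 : Tendsto (fun j => ‖q (φ j) - z‖) atTop (𝓝 ‖q₀ - z‖) := (hq.sub_const z).norm
    simp only [hqn] at h1
    exact (tendsto_nhds_unique h1 tendsto_const_nhds)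
  have lsc_le : ∀ {h : EuclideanSpace ℝ (Fin n) → ℝ} {b : ℝ}, ConvexOn ℝ Set.univ h →
      LowerSemicontinuous h → h z ≤ b → (∀ j, h (w j) ≤ b + M) → h q₀ ≤ b := by
    intro h b hcv hlsc hzb hwb
    by_contra! hlt
    obtain ⟨b', hb1, hb2⟩ := exists_between hlt
    have e1 := hq.eventually (hlsc q₀ b' hb2)
    have e2 : ∀ᶠ j in atTop, t (φ j) * M < b' - b := by
      have h1 : Tendsto (fun j => t (φ j) * M) atTop (𝓝 (0 * M)) :=
        (htlim.comp hφ.tendsto_atTop).mul_const M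
      exact h1.eventually_lt_const (by simpa using hb1)
    obtain ⟨j, h1, h2⟩ := (e1.and e2).exists
    have h1t := sub_nonneg.2 (ht1 (φ j))
    have h3 : h (q (φ j)) ≤ (1 - t (φ j)) * h z + t (φ j) * h (w (φ j)) :=
      hcv.2 (Set.mem_univ _) (Set.mem_univ _) h1t (ht0 _).le (by ring)
    have h4 := mul_le_mul_of_nonneg_left hzb h1t
    have h5 := mul_le_mul_of_nonneg_left (hwb (φ j)) (ht0 (φ j)).le
    simp only [Function.comp] at h1
    linarith
  have hq₀ : q₀ ∈ {z | P.Feasible z ∧ P.f₀ z ≤ α} :=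
    ⟨⟨P.isClosed_C.mem_of_tendsto hq (Eventually.of_forall fun j =>
        P.convex_C hz.1 (hw _).1 (sub_nonneg.2 (ht1 _)) (ht0 _).le (by ring)),
      fun i => lsc_le (P.convexOn_f i) (P.lsc_f i) (hz.2 i) fun j => by
        simpa using (hw j).2.1 i⟩,
      lsc_le P.convexOn_f₀ P.lsc_f₀ hzα fun j => (hw j).2.2⟩
  have h1 := hR q₀ hq₀
  have h2 := norm_sub_le q₀ z
  linarith

end ConvexProgram
end

/-! ### Runs of the method -/

noncomputable section
namespace ConvexProgram

variable {n m : ℕ} {P : ConvexProgram n m} {c ε : ℕ → ℝ} {x : ℕ → EuclideanSpace ℝ (Fin n)}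
  {y : ℕ → EuclideanSpace ℝ (Fin m)}

/-- Replacing the infimum by its value at a point of `C` makes the subtrahend real, so no `EReal`
convention for infinite differences intervenes. -/
theorem near_minimizer_of_criterion {z : EuclideanSpace ℝ (Fin n)}
    {u : EuclideanSpace ℝ (Fin m)} {a e : ℝ}
    (h : P.augLagrangian z u a - (⨅ w : EuclideanSpace ℝ (Fin n), P.augLagrangian w u a) ≤
      (e : EReal)) :
    z ∈ P.C ∧ ∀ w ∈ P.C, P.augReal z u a ≤ P.augReal w u a + e := by
  have hle : ∀ w ∈ P.C, P.augLagrangian z u a - (P.augReal w u a : EReal) ≤ (e : EReal) := by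
    intro w hw
    refine (EReal.sub_le_sub le_rfl ((iInf_le _ w).trans (le_of_eq ?_))).trans h
    exact if_pos hw
  have hz : z ∈ P.C := by
    by_contra hz
    obtain ⟨w, hw⟩ := P.nonempty_C
    have h1 := hle w hw
    have h2 : P.augLagrangian z u a = ⊤ := if_neg hz
    rw [h2, EReal.top_sub_coe] at h1
    exact (EReal.coe_lt_top e).not_ge h1
  refine ⟨hz, fun w hw => ?_⟩
  have h1 := hle w hw
  have h2 : P.augLagrangian z u a = (P.augReal z u a : EReal) := if_pos hz
  rw [h2, ← EReal.coe_sub, EReal.coe_le_coe_iff] at h1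
  linarith

namespace IsRun

theorem c_pos (hrun : P.IsRun c ε x y) (k : ℕ) : 0 < c k := by
  obtain ⟨c₀, h0, h⟩ := hrun.c_bound
  exact h0.trans_le (h k)

theorem nonneg (hrun : P.IsRun c ε x y) (k : ℕ) (i : Fin m) : 0 ≤ y k i := by
  cases k with
  | zero => exact hrun.y_zero i
  | succ k =>
    rw [hrun.step k]
    have h1 := mul_nonneg (show (0 : ℝ) ≤ 1 / ((k : ℝ) + 2) by positivity) (hrun.y_zero i)
    have h2 := mul_nonneg (show (0 : ℝ) ≤ ((k : ℝ) + 1) / ((k : ℝ) + 2) by positivity)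
      (multiplier_nonneg (P := P) (x (k + 1)) (y k) (c k) i)
    simpa using add_nonneg h1 h2

theorem exists_prox (hrun : P.IsRun c ε x y) (hS : P.dualDomain.Nonempty) :
    ∃ p : ℕ → EuclideanSpace ℝ (Fin m), ∀ k, x (k + 1) ∈ P.C ∧
      IsProxPoint P.dualDomain P.dualVal (c k) (y k) (p k) ∧
      ‖P.multiplier (x (k + 1)) (y k) (c k) - p k‖ ≤ ε k ∧
      P.augReal (x (k + 1)) (y k) (c k) ≤ P.dualVal (p k) + ε k ^ 2 / (2 * c k) := by
  have h : ∀ k, ∃ p, x (k + 1) ∈ P.C ∧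
      IsProxPoint P.dualDomain P.dualVal (c k) (y k) p ∧
      ‖P.multiplier (x (k + 1)) (y k) (c k) - p‖ ≤ ε k ∧
      P.augReal (x (k + 1)) (y k) (c k) ≤ P.dualVal p + ε k ^ 2 / (2 * c k) := by
    intro k
    have hc := hrun.c_pos k
    obtain ⟨p, hp, hx⟩ := exists_isProxPoint (y k) hS hc
    obtain ⟨hC, hmin⟩ := near_minimizer_of_criterion (hrun.criterion k)
    obtain ⟨h1, h2⟩ := hx _ hC _ hmin
    refine ⟨p, hC, hp, ?_, h2⟩
    rw [mul_div_cancel₀ _ (by positivity)] at h1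
    exact abs_le_of_sq_le_sq' h1 (hrun.ε_nonneg k) |>.2
  choose p hp using h
  exact ⟨p, hp⟩

theorem isBounded_of_isDualOptimal (hrun : P.IsRun c ε x y) (hS : P.dualDomain.Nonempty)
    {s : EuclideanSpace ℝ (Fin m)} (hs : P.IsDualOptimal s) :
    Bornology.IsBounded (Set.range y) := by
  obtain ⟨p, hp⟩ := hrun.exists_prox hS
  obtain ⟨h1, h2⟩ := (isDualOptimal_iff hS).1 hs
  obtain ⟨R, hR⟩ := halpern_norm_sub_le hrun.ε_nonneg hrun.ε_summable hrun.c_pos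
    (fun k => (hp k).2.1) (fun k => (hp k).2.2.1) hrun.step h1 h2
  refine (Metric.isBounded_closedBall (x := s) (r := R)).subset ?_
  rintro _ ⟨k, rfl⟩
  simpa [dist_eq_norm] using hR k

theorem exists_tendsto (hrun : P.IsRun c ε x y) (hS : P.dualDomain.Nonempty)
    (hb : Bornology.IsBounded (Set.range y)) :
    ∃ s, P.IsDualOptimal s ∧ Tendsto y atTop (𝓝 s) := by
  obtain ⟨p, hp⟩ := hrun.exists_prox hS
  obtain ⟨c₀, hc₀, hc⟩ := hrun.c_bound
  obtain ⟨s, hs, hmax, hlim⟩ := halpern_tendsto_of_isBounded isClosed_dual_superlevel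
    convex_dual_superlevel hrun.ε_nonneg hrun.ε_summable hc₀ hc (fun k => (hp k).2.1)
    (fun k => (hp k).2.2.1) hrun.step hb fun B hB => exists_dualVal_max_on_compact hB
  exact ⟨s, (isDualOptimal_iff hS).2 ⟨hs, hmax⟩, hlim⟩

theorem constraint_le (hrun : P.IsRun c ε x y) (i : Fin m) (k : ℕ) :
    P.f i (x (k + 1)) ≤
      1 / c k * (y (k + 1) i - y k i + 1 / ((k : ℝ) + 1) * (y (k + 1) i - y 0 i)) := by
  have hc := hrun.c_pos k
  have h1 := congrArg (fun u : EuclideanSpace ℝ (Fin m) => u i) (halpern_increment_eq hrun.step k)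
  simp only [PiLp.sub_apply, PiLp.smul_apply, smul_eq_mul] at h1
  have h2 : y k i + c k * P.f i (x (k + 1)) ≤ P.multiplier (x (k + 1)) (y k) (c k) i :=
    le_max_left _ _
  rw [one_div (c k), inv_mul_eq_div, le_div_iff₀ hc]
  linarith

/-- Along a convergent run, quantities divided by the penalty parameters still vanish. -/
theorem tendsto_div_zero (hrun : P.IsRun c ε x y) {q a : ℕ → ℝ} (ha : Tendsto a atTop (𝓝 0))
    {b : ℝ} (hb : 0 < b) (hq : ∀ k, q k = 1 / (b * c k)) :
    Tendsto (fun k => q k * a k) atTop (𝓝 0) := by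
  obtain ⟨c₀, hc₀, hc⟩ := hrun.c_bound
  refine squeeze_zero_norm (a := fun k => 1 / (b * c₀) * ‖a k‖) (fun k => ?_)
    (by simpa using ha.norm.const_mul (1 / (b * c₀)))
  have hk := hrun.c_pos k
  rw [norm_mul, hq, Real.norm_of_nonneg (by positivity)]
  gcongr
  exact hc k

theorem tendsto_constraint_bound (hrun : P.IsRun c ε x y) {s : EuclideanSpace ℝ (Fin m)}
    (hlim : Tendsto y atTop (𝓝 s)) (i : Fin m) :
    Tendsto (fun k : ℕ =>
      1 / c k * (y (k + 1) i - y k i + 1 / ((k : ℝ) + 1) * (y (k + 1) i - y 0 i)))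
      atTop (𝓝 0) := by
  have h1 : Tendsto (fun k => y k i) atTop (𝓝 (s i)) :=
    ((by fun_prop : Continuous fun u : EuclideanSpace ℝ (Fin m) => u i).tendsto s).comp hlim
  have h2 := (tendsto_add_atTop_iff_nat 1).2 h1
  refine hrun.tendsto_div_zero (b := 1) ?_ one_pos (fun k => by rw [one_mul])
  simpa using (h2.sub h1).add
    ((tendsto_one_div_add_atTop_nhds_zero_nat (𝕜 := ℝ)).mul (h2.sub_const (y 0 i)))

/-- Expands the square of `y (k + 1) + (y (k + 1) - y 0) / (k + 1)`; the factor `2 * k + 3` is `2 *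
(k + 1) + 1`. -/
theorem norm_multiplier_sq (hrun : P.IsRun c ε x y) (k : ℕ) :
    ‖P.multiplier (x (k + 1)) (y k) (c k)‖ ^ 2 = ‖y (k + 1)‖ ^ 2 +
      (2 * (k : ℝ) + 3) / ((k : ℝ) + 1) ^ 2 *
        inner ℝ (y (k + 1) - y 0) (y (k + 1) - ((1 : ℝ) / (2 * (k : ℝ) + 3)) • y 0) := by
  have h1 : P.multiplier (x (k + 1)) (y k) (c k) =
      y (k + 1) + ((1 : ℝ) / ((k : ℝ) + 1)) • (y (k + 1) - y 0) := by
    rw [← halpern_increment_eq hrun.step k]; abel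
  rw [h1, norm_add_sq_real, norm_smul, mul_pow, Real.norm_eq_abs, sq_abs, norm_sub_sq_real]
  simp only [inner_sub_left, inner_sub_right, real_inner_smul_right, real_inner_self_eq_norm_sq,
    real_inner_comm (y (k + 1)) (y 0)]
  field_simp
  ring

theorem objective_sub_le (hrun : P.IsRun c ε x y) (hS : P.dualDomain.Nonempty)
    {s : EuclideanSpace ℝ (Fin m)} (hs : P.IsDualOptimal s) (k : ℕ) :
    P.f₀ (x (k + 1)) - P.dualVal s ≤ 1 / (2 * c k) * (ε k ^ 2 + ‖y k‖ ^ 2 -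
      ‖P.multiplier (x (k + 1)) (y k) (c k)‖ ^ 2) := by
  obtain ⟨p, hp⟩ := hrun.exists_prox hS
  have h1 := (hp k).2.2.2
  have h2 := ((isDualOptimal_iff hS).1 hs).2 _ (hp k).2.1.1
  unfold augReal at h1
  have h3 : 1 / (2 * c k) * (ε k ^ 2 + ‖y k‖ ^ 2 -
      ‖P.multiplier (x (k + 1)) (y k) (c k)‖ ^ 2) = ε k ^ 2 / (2 * c k) -
      1 / (2 * c k) * (‖P.multiplier (x (k + 1)) (y k) (c k)‖ ^ 2 - ‖y k‖ ^ 2) := by ring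
  linarith

theorem tendsto_objective_bound (hrun : P.IsRun c ε x y) {s : EuclideanSpace ℝ (Fin m)}
    (hlim : Tendsto y atTop (𝓝 s)) :
    Tendsto (fun k : ℕ => 1 / (2 * c k) * (ε k ^ 2 + ‖y k‖ ^ 2 -
      ‖P.multiplier (x (k + 1)) (y k) (c k)‖ ^ 2)) atTop (𝓝 0) := by
  refine hrun.tendsto_div_zero (b := 2) ?_ two_pos (fun k => rfl)
  have h1 := halpern_increment_tendsto_zero hrun.step (Metric.isBounded_range_of_tendsto _ hlim)
  have h2 : Tendsto (fun k => P.multiplier (x (k + 1)) (y k) (c k)) atTop (𝓝 s) := by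
    simpa using h1.add ((tendsto_add_atTop_iff_nat 1).2 hlim)
  have h3 := ((hrun.ε_summable.tendsto_atTop_zero.pow 2).add (hlim.norm.pow 2)).sub
    (h2.norm.pow 2)
  simpa using h3

theorem eventually_objective_lt (hrun : P.IsRun c ε x y) (hS : P.dualDomain.Nonempty)
    {s : EuclideanSpace ℝ (Fin m)} (hs : P.IsDualOptimal s) (hlim : Tendsto y atTop (𝓝 s))
    {z : ℝ} (hz : P.dualVal s < z) : ∀ᶠ k in atTop, P.f₀ (x (k + 1)) < z := by
  filter_upwards [(hrun.tendsto_objective_bound hlim).eventually_lt_const (sub_pos.2 hz)] with k hk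
  linarith [hrun.objective_sub_le hS hs k]

theorem eventually_constraint_lt (hrun : P.IsRun c ε x y)
    {s : EuclideanSpace ℝ (Fin m)} (hlim : Tendsto y atTop (𝓝 s)) (i : Fin m)
    {z : ℝ} (hz : 0 < z) : ∀ᶠ k in atTop, P.f i (x (k + 1)) < z := by
  filter_upwards [(hrun.tendsto_constraint_bound hlim i).eventually_lt_const hz] with k hk
  exact (hrun.constraint_le i k).trans_lt hk

theorem mem_C (hrun : P.IsRun c ε x y) (k : ℕ) : x (k + 1) ∈ P.C :=
  (near_minimizer_of_criterion (hrun.criterion k)).1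

theorem asympFeasible (hrun : P.IsRun c ε x y)
    {s : EuclideanSpace ℝ (Fin m)} (hlim : Tendsto y atTop (𝓝 s)) :
    P.AsympFeasible fun k => x (k + 1) := by
  refine ⟨hrun.mem_C, fun i => ?_⟩
  rw [← EReal.coe_zero, EReal.limsup_coe_le_iff]
  exact fun z hz => hrun.eventually_constraint_lt hlim i hz

/-- A sandwich: the limsup is at most `max (D)`, which is at most the asymptotic infimum, which is
at most the limsup. -/
theorem asympMinimizing (hrun : P.IsRun c ε x y) (hS : P.dualDomain.Nonempty)
    {s : EuclideanSpace ℝ (Fin m)} (hs : P.IsDualOptimal s) (hlim : Tendsto y atTop (𝓝 s)) :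
    P.IsAsympMinimizing (fun k => x (k + 1)) ∧ P.asympInf = (P.dualVal s : EReal) := by
  have hf := hrun.asympFeasible hlim
  have h1 : limsup (fun k => (P.f₀ (x (k + 1)) : EReal)) atTop ≤ (P.dualVal s : EReal) :=
    EReal.limsup_coe_le_iff.2 fun z hz => hrun.eventually_objective_lt hS hs hlim hz
  have h2 : P.asympInf ≤ limsup (fun k => (P.f₀ (x (k + 1)) : EReal)) atTop :=
    iInf₂_le (fun k => x (k + 1)) hf
  have h3 : (P.dualVal s : EReal) ≤ P.asympInf := by
    rw [coe_dualVal ((isDualOptimal_iff hS).1 hs).1, hs.dualFun_eq]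
    exact dualSup_le_asympInf
  exact ⟨⟨hf, le_antisymm (h1.trans h3) h2⟩, le_antisymm (h2.trans h1) h3⟩

theorem isBounded_primal (hrun : P.IsRun c ε x y) (hS : P.dualDomain.Nonempty)
    {s : EuclideanSpace ℝ (Fin m)} (hs : P.IsDualOptimal s) (hlim : Tendsto y atTop (𝓝 s)) {α : ℝ}
    (hne : {z | P.Feasible z ∧ P.f₀ z ≤ α}.Nonempty)
    (hb : Bornology.IsBounded {z | P.Feasible z ∧ P.f₀ z ≤ α}) :
    Bornology.IsBounded (Set.range fun k => x (k + 1)) := by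
  have hbd : ∀ i, ∃ M, ∀ k, P.f i (x (k + 1)) ≤ M := fun i => by
    obtain ⟨M, hM⟩ := (hrun.tendsto_constraint_bound hlim i).bddAbove_range
    exact ⟨M, fun k => (hrun.constraint_le i k).trans (hM ⟨k, rfl⟩)⟩
  choose M hM using hbd
  obtain ⟨M₀, hM₀⟩ := (hrun.tendsto_objective_bound hlim).bddAbove_range
  -- One relaxation level large enough for all constraints and the objective at once.
  set N := ∑ i, |M i| + |M₀ + P.dualVal s - α|
  have hsum : ∀ i, |M i| ≤ ∑ i, |M i| := fun i =>
    Finset.single_le_sum (f := fun i => |M i|) (fun _ _ => abs_nonneg _) (Finset.mem_univ i)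
  refine (isBounded_relaxed_sublevel hne hb N).subset ?_
  rintro _ ⟨k, rfl⟩
  refine ⟨hrun.mem_C k, fun i => ?_, ?_⟩
  · linarith [hM i k, le_abs_self (M i), hsum i, abs_nonneg (M₀ + P.dualVal s - α)]
  · have h1 := hrun.objective_sub_le hS hs k
    have h2 := hM₀ ⟨k, rfl⟩
    have h3 : 0 ≤ ∑ i, |M i| := Finset.sum_nonneg fun _ _ => abs_nonneg _
    simp only at h2 ⊢
    linarith [le_abs_self (M₀ + P.dualVal s - α)]

theorem isPrimalOptimal_of_mapClusterPt (hrun : P.IsRun c ε x y) (hS : P.dualDomain.Nonempty)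
    {s : EuclideanSpace ℝ (Fin m)} (hs : P.IsDualOptimal s) (hlim : Tendsto y atTop (𝓝 s))
    {z : EuclideanSpace ℝ (Fin n)} (hz : MapClusterPt z atTop fun k => x (k + 1)) :
    P.IsPrimalOptimal z := by
  have lsc_le : ∀ {h : EuclideanSpace ℝ (Fin n) → ℝ} {b : ℝ}, LowerSemicontinuous h →
      (∀ b' > b, ∀ᶠ k in atTop, h (x (k + 1)) < b') → h z ≤ b := by
    intro h b hl he
    by_contra! hlt
    obtain ⟨b', h1, h2⟩ := exists_between hlt
    obtain ⟨k, hk1, hk2⟩ := ((hz.frequently (hl z b' h2)).and_eventually (he b' h1)).exists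
    exact lt_asymm hk1 hk2
  refine ⟨⟨?_, fun i => lsc_le (P.lsc_f i) fun b hb => hrun.eventually_constraint_lt hlim i hb⟩,
    fun w hw => ?_⟩
  · by_contra hzC
    obtain ⟨k, hk⟩ := (hz.frequently (P.isClosed_C.isOpen_compl.mem_nhds hzC)).exists
    exact hk (hrun.mem_C k)
  · have h1 : P.f₀ z ≤ P.dualVal s :=
      lsc_le P.lsc_f₀ fun b hb => hrun.eventually_objective_lt hS hs hlim hb
    have h2 : (P.dualVal s : EReal) ≤ (P.f₀ w : EReal) := by
      rw [← (hrun.asympMinimizing hS hs hlim).2]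
      exact asympInf_le_primalInf.trans (iInf₂_le w hw)
    exact h1.trans (EReal.coe_le_coe_iff.1 h2)

end IsRun

end ConvexProgram

end

/-! ### Assembly -/

theorem theorem4p1 {n m : ℕ} (P : ConvexProgram n m) (hD : ⊥ < P.dualSup)
    (c ε : ℕ → ℝ) (x : ℕ → EuclideanSpace ℝ (Fin n)) (y : ℕ → EuclideanSpace ℝ (Fin m))
    (hrun : P.IsRun c ε x y) :
    -- the multipliers stay in the nonnegative orthant
    (∀ k i, 0 ≤ y k i) ∧
    -- convergence and error bounds when the multipliers are bounded
    (Bornology.IsBounded (Set.range y) →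
      (∃ yinf, P.IsDualOptimal yinf ∧ Tendsto y atTop (𝓝 yinf)) ∧
      P.IsAsympMinimizing (fun k => x (k + 1)) ∧
      (∀ i,
        (∀ k : ℕ, P.f i (x (k + 1)) ≤
          1 / c k * (y (k + 1) i - y k i + 1 / ((k : ℝ) + 1) * (y (k + 1) i - y 0 i))) ∧
        Tendsto (fun k : ℕ =>
          1 / c k * (y (k + 1) i - y k i + 1 / ((k : ℝ) + 1) * (y (k + 1) i - y 0 i)))
          atTop (𝓝 0)) ∧
      (∃ v : ℝ, P.asympInf = (v : EReal) ∧
        ∀ k : ℕ, P.f₀ (x (k + 1)) - v ≤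
          1 / (2 * c k) * (ε k ^ 2 + ‖y k‖ ^ 2 - ‖y (k + 1)‖ ^ 2 -
            (2 * (k : ℝ) + 3) / ((k : ℝ) + 1) ^ 2 *
              inner ℝ (y (k + 1) - y 0)
                (y (k + 1) - ((1 : ℝ) / (2 * (k : ℝ) + 3)) • y 0)))) ∧
    -- boundedness of the multipliers and solvability of the dual problem
    (Bornology.IsBounded (Set.range y) ↔ ∃ ybar, P.IsDualOptimal ybar) ∧
    -- the Slater condition
    (P.Slater →
      Bornology.IsBounded (Set.range y) ∧
      (∃ ybar, P.IsDualOptimal ybar ∧ P.dualFun ybar = P.dualSup) ∧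
      P.dualSup = P.primalInf ∧ P.primalInf = P.asympInf) ∧
    -- boundedness and optimality of the primal iterates
    (Bornology.IsBounded (Set.range y) →
      (∃ α₀ : ℝ, {z | P.Feasible z ∧ P.f₀ z ≤ α₀}.Nonempty ∧
        Bornology.IsBounded {z | P.Feasible z ∧ P.f₀ z ≤ α₀}) →
      Bornology.IsBounded (Set.range fun k => x (k + 1)) ∧
      ∀ z, MapClusterPt z atTop (fun k => x (k + 1)) → P.IsPrimalOptimal z) := by
  have hS := ConvexProgram.nonempty_dualDomain hD
  refine ⟨hrun.nonneg, fun hb => ?_, ⟨fun hb => ?_, ?_⟩, fun hsl => ?_, fun hb ⟨α, hne, hα⟩ => ?_⟩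
  · obtain ⟨s, hs, hlim⟩ := hrun.exists_tendsto hS hb
    obtain ⟨hmin, hval⟩ := hrun.asympMinimizing hS hs hlim
    refine ⟨⟨s, hs, hlim⟩, hmin,
      fun i => ⟨hrun.constraint_le i, hrun.tendsto_constraint_bound hlim i⟩,
      P.dualVal s, hval, fun k => (hrun.objective_sub_le hS hs k).trans (le_of_eq ?_)⟩
    rw [hrun.norm_multiplier_sq k]; ring
  · obtain ⟨s, hs, -⟩ := hrun.exists_tendsto hS hb
    exact ⟨s, hs⟩
  · rintro ⟨s, hs⟩
    exact hrun.isBounded_of_isDualOptimal hS hs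
  · obtain ⟨u, hu⟩ := ConvexProgram.exists_isDualOptimal_of_slater hS hsl
    have hb := hrun.isBounded_of_isDualOptimal hS hu
    obtain ⟨s, hs, hlim⟩ := hrun.exists_tendsto hS hb
    have hval := (hrun.asympMinimizing hS hs hlim).2
    have hsup : P.dualSup = P.asympInf := by
      rw [hval, ConvexProgram.coe_dualVal ((ConvexProgram.isDualOptimal_iff hS).1 hs).1,
        hs.dualFun_eq]
    -- Strong duality comes from the run itself: its iterates are shifted to feasibility, with no
    -- separation argument.
    have hprim : P.primalInf = P.asympInf := by
      refine le_antisymm ?_ ConvexProgram.asympInf_le_primalInf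
      rw [hval]
      exact ConvexProgram.primalInf_le_of_slater hsl (hrun.asympFeasible hlim)
        fun z hz => hrun.eventually_objective_lt hS hs hlim hz
    exact ⟨hb, ⟨s, hs, hs.dualFun_eq⟩, hsup.trans hprim.symm, hprim⟩
  · obtain ⟨s, hs, hlim⟩ := hrun.exists_tendsto hS hb
    exact ⟨hrun.isBounded_primal hS hs hlim hne hα,
      fun z hz => hrun.isPrimalOptimal_of_mapClusterPt hS hs hlim hz⟩
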